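/- Let $p,q\ge 1$ be coprime integers, and let $D(T_{p,q})$ be the standard diagram of the $(p,q)$-torus knot: the closure of the $p$-strand braid diagram $(\sigma_1\sigma_2\cdots\sigma_{p-1})^q$, in which each of the $q$ factors $\sigma_1\cdots\sigma_{p-1}$ consists of one overstrand running from the leftmost to the rightmost place across the $p-1$ other strands. Call these overstrands $a_1,\dots,a_q$, in order. Let $VT^1_{p,q}$ be the virtual knot represented by the virtual knot diagram obtained from $D(T_{p,q})$ by replacing every classical crossing at which $a_1$ is the overstrand by a virtual crossing. (Virtual knots are virtual knot diagrams up to isotopy and generalized Reidemeister moves.) Then $VT^1_{p,q}$ can be modified into the unknot by generalized Reidemeister moves and crossing changes, and the minimal number $vu(VT^1_{p,q})$ of crossing changes needed to do so, its virtual unknotting number, is $$vu(VT^1_{p,q})=\frac{(p-1)(q-1)}{2}.$$ -/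

import Mathlib

namespace VirtualKnot

/-! Virtual link diagrams in the plane, cut by horizontal lines into elementary pieces and read
from bottom to top. Between two consecutive lines there is exactly one elementary piece
(a local minimum, a local maximum, or a crossing); all other strands are vertical. On each line
the strands are numbered `0, 1, 2, …` from left to right. Diagrams are unoriented. -/

/-- The crossings that two upward strands can form: `pos` is the classical crossing at which the
strand from lower left to upper right is the overstrand (it is positive when both strands are
oriented upwards), `neg` is the classical crossing at which that strand is the understrand,
and `virt` is the virtual crossing. -/
inductive Crossing
  | pos
  | neg
  | virt

/-- Exchange the overstrand and the understrand; a virtual crossing is unchanged. -/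
def Crossing.flip : Crossing → Crossing
  | pos => neg
  | neg => pos
  | virt => virt

/-- The kinds of elementary pieces: a local minimum `∪`, a local maximum `∩`, a crossing. -/
inductive Kind
  | cup
  | cap
  | cross (c : Crossing)

/-- Number of strands that enter a piece from below. -/
def Kind.bottom : Kind → ℕ
  | cup => 0
  | cap => 2
  | cross _ => 2

/-- Number of strands that leave a piece at the top. -/
def Kind.top : Kind → ℕ
  | cup => 2
  | cap => 0
  | cross _ => 2

/-- An elementary piece, with exactly `place` vertical strands to its left. -/
structure Piece where
  kind : Kind
  place : ℕ

/-- A local minimum whose two strands get the numbers `i` and `i + 1`. -/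
def cup (i : ℕ) : Piece := ⟨Kind.cup, i⟩

/-- A local maximum that joins the strands `i` and `i + 1`. -/
def cap (i : ℕ) : Piece := ⟨Kind.cap, i⟩

/-- A crossing of the strands `i` and `i + 1`. -/
def cross (c : Crossing) (i : ℕ) : Piece := ⟨Kind.cross c, i⟩

/-- The piece fits between a line with `n` strands and a line with `m` strands
(`r` is the number of vertical strands to its right). -/
def Piece.Joins (x : Piece) (n m : ℕ) : Prop :=
  ∃ r : ℕ, n = x.place + x.kind.bottom + r ∧ m = x.place + x.kind.top + r

/-- The pieces, stacked from bottom to top, fit between `n` strands below and `m` above. -/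
def Joins : List Piece → ℕ → ℕ → Prop
  | [], n, m => n = m
  | x :: w, n, m => ∃ l : ℕ, x.Joins n l ∧ Joins w l m

/-- A virtual link diagram: a stack of elementary pieces without free ends. -/
structure Diagram where
  word : List Piece
  closed : Joins word 0 0

/-- The local moves: isotopy of the plane, and the generalized Reidemeister moves R1, R2, R3,
VR1, VR2, VR3 and MR, in all positions with respect to the height function. -/
inductive LocalMove : List Piece → List Piece → Prop
  /- Isotopy: two pieces side by side are exchanged in height (`d` strands lie between them). -/
  | exchange (x y : Kind) (i d : ℕ) :
      LocalMove [⟨x, i⟩, ⟨y, i + x.top + d⟩] [⟨y, i + x.bottom + d⟩, ⟨x, i⟩]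
  /- Isotopy: a strand that goes up, down and up again is straightened. -/
  | zigzag_right (i : ℕ) : LocalMove [cup i, cap (i + 1)] []
  | zigzag_left (i : ℕ) : LocalMove [cup (i + 1), cap i] []
  /- Isotopy: a crossing is slid through a local minimum or maximum of one of its strands. -/
  | slide_cup (c : Crossing) (i : ℕ) :
      LocalMove [cup (i + 1), cross c i] [cup i, cross c.flip (i + 1)]
  | slide_cap (c : Crossing) (i : ℕ) :
      LocalMove [cross c i, cap (i + 1)] [cross c.flip (i + 1), cap i]
  /- R1 for `pos` and `neg`, VR1 for `virt`: a kink is removed. -/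
  | r1_cup (c : Crossing) (i : ℕ) : LocalMove [cup i, cross c i] [cup i]
  | r1_cap (c : Crossing) (i : ℕ) : LocalMove [cross c i, cap i] [cap i]
  /- R2 for `pos` and `neg`, VR2 for `virt`: a bigon is removed. -/
  | r2 (c : Crossing) (i : ℕ) : LocalMove [cross c i, cross c.flip i] []
  /- R3: of the three strands, one lies above the two others and one below the two others. -/
  | r3 (a b c : Crossing) (i : ℕ) (ha : a ≠ .virt) (hb : b ≠ .virt) (hc : c ≠ .virt)
      (h : ¬ (a = c ∧ b = a.flip)) :
      LocalMove [cross a i, cross b (i + 1), cross c i]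
        [cross c (i + 1), cross b i, cross a (i + 1)]
  /- VR3. -/
  | vr3 (i : ℕ) :
      LocalMove [cross .virt i, cross .virt (i + 1), cross .virt i]
        [cross .virt (i + 1), cross .virt i, cross .virt (i + 1)]
  /- MR: a strand with two virtual crossings is moved across a classical crossing. -/
  | mr_first (c : Crossing) (i : ℕ) (hc : c ≠ .virt) :
      LocalMove [cross c i, cross .virt (i + 1), cross .virt i]
        [cross .virt (i + 1), cross .virt i, cross c (i + 1)]
  | mr_second (c : Crossing) (i : ℕ) (hc : c ≠ .virt) :
      LocalMove [cross .virt i, cross c (i + 1), cross .virt i]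
        [cross .virt (i + 1), cross c i, cross .virt (i + 1)]
  | mr_third (c : Crossing) (i : ℕ) (hc : c ≠ .virt) :
      LocalMove [cross .virt i, cross .virt (i + 1), cross c i]
        [cross c (i + 1), cross .virt i, cross .virt (i + 1)]

/-- `E` is obtained from `D` by one local move. -/
def Diagram.Move (D E : Diagram) : Prop :=
  ∃ u v a b : List Piece, LocalMove a b ∧ D.word = u ++ a ++ v ∧ E.word = u ++ b ++ v

/-- `E` is obtained from `D` by one crossing change. -/
def Diagram.CrossingChange (D E : Diagram) : Prop :=
  ∃ (u v : List Piece) (c : Crossing) (i : ℕ), c ≠ .virt ∧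
    D.word = u ++ [cross c i] ++ v ∧ E.word = u ++ [cross c.flip i] ++ v

/-- Virtual links: virtual link diagrams up to the equivalence relation generated by
isotopy and generalized Reidemeister moves. -/
def VirtualLink : Type := Quot Diagram.Move

/-- The virtual link represented by a diagram. -/
def Diagram.toLink (D : Diagram) : VirtualLink := Quot.mk _ D

/-- `L` is obtained from `K` by one crossing change, on some diagram of `K`. -/
def VirtualLink.CrossingChange (K L : VirtualLink) : Prop :=
  ∃ D E : Diagram, D.toLink = K ∧ E.toLink = L ∧ D.CrossingChange E

/-- The round circle, without crossings. -/
def circle : Diagram where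
  word := [cup 0, cap 0]
  closed := ⟨2, ⟨0, rfl, rfl⟩, 0, ⟨0, rfl, rfl⟩, rfl⟩

/-- The unknot. -/
def unknot : VirtualLink := circle.toLink

/-- Virtually homotopic: related by generalized Reidemeister moves and crossing changes. -/
def VirtuallyHomotopic : VirtualLink → VirtualLink → Prop :=
  Relation.EqvGen VirtualLink.CrossingChange

/-- Virtually homotopic to the unknot. -/
def VirtuallyNullHomotopic (K : VirtualLink) : Prop := VirtuallyHomotopic K unknot

/-- `K` can be modified into the unknot with exactly `n` crossing changes. -/
inductive UnknotsIn : ℕ → VirtualLink → Prop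
  | zero : UnknotsIn 0 unknot
  | succ (n : ℕ) (K L : VirtualLink) (h : K.CrossingChange L) (hL : UnknotsIn n L) :
      UnknotsIn (n + 1) K

/-- The virtual unknotting number: the minimal number of crossing changes that modify `K` into
the unknot. It is meaningful for virtually null-homotopic `K`, for which the set is not empty. -/
noncomputable def virtualUnknottingNumber (K : VirtualLink) : ℕ :=
  sInf {n : ℕ | UnknotsIn n K}

/-- The leftmost of `p` upward strands runs to the right across all the others, with crossings
of type `c`. -/
def pass (c : Crossing) (p : ℕ) : List Piece := (List.range (p - 1)).map (cross c)

/-- The standard `p`-strand braid diagram of the `(p, q)`-torus link, in which `q` overstrands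
`a_1, …, a_q` successively run from the leftmost to the rightmost place, with all classical
crossings on `a_1, …, a_n` made virtual. For `n = 0` nothing is virtualized. -/
def virtualTorusBraid (p q n : ℕ) : List Piece :=
  (List.range q).flatMap fun m => pass (if m < n then Crossing.virt else Crossing.pos) p

/-- The closure of a braid diagram on `p` strands: the `p` strands are closed by `p` parallel
strands without crossings on their right. -/
def closure (p : ℕ) (w : List Piece) : List Piece :=
  (List.range p).map cup ++ w ++ (List.range p).reverse.map cap

theorem joins_append {u v : List Piece} {n l m : ℕ} (hu : Joins u n l) (hv : Joins v l m) :
    Joins (u ++ v) n m := by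
  induction u generalizing n with
  | nil => cases hu; exact hv
  | cons x u ih =>
    obtain ⟨k, hx, hk⟩ := hu
    exact ⟨k, hx, ih hk⟩

theorem joins_cups (p : ℕ) : Joins ((List.range p).map cup) 0 (2 * p) := by
  induction p with
  | zero => rfl
  | succ p ih =>
    rw [List.range_succ, List.map_append]
    refine joins_append ih ⟨2 * p + 2, ⟨p, ?_, ?_⟩, ?_⟩ <;>
      simp [cup, Kind.bottom, Kind.top, Joins] <;> omega

theorem joins_caps (p : ℕ) : Joins ((List.range p).reverse.map cap) (2 * p) 0 := by
  induction p with
  | zero => rfl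
  | succ p ih =>
    rw [List.range_succ, List.reverse_append, List.map_append]
    refine joins_append (l := 2 * p) ⟨2 * p, ⟨p, ?_, ?_⟩, rfl⟩ ih <;>
      simp [cap, Kind.bottom, Kind.top] <;> omega

theorem joins_crossings (p : ℕ) (w : List Piece)
    (hw : ∀ x ∈ w, ∃ (c : Crossing) (i : ℕ), x = cross c i ∧ i + 1 < p) :
    Joins w (2 * p) (2 * p) := by
  induction w with
  | nil => rfl
  | cons x w ih =>
    obtain ⟨c, i, rfl, hi⟩ := hw x (by simp)
    refine ⟨2 * p, ⟨2 * p - i - 2, ?_, ?_⟩, ih fun y hy => hw y (by simp [hy])⟩ <;>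
      simp [cross, Kind.bottom, Kind.top] <;> omega

theorem joins_closure (p q n : ℕ) : Joins (closure p (virtualTorusBraid p q n)) 0 0 := by
  refine joins_append (joins_append (joins_cups p) (joins_crossings p _ ?_)) (joins_caps p)
  intro x hx
  simp only [virtualTorusBraid, pass, List.mem_flatMap, List.mem_map, List.mem_range] at hx
  obtain ⟨m, -, i, hi, rfl⟩ := hx
  exact ⟨_, i, rfl, by omega⟩

/-- The diagram obtained from the standard diagram of the `(p, q)`-torus link, with braid index
`p`, by virtualizing all classical crossings at which one of `a_1, …, a_n` is the overstrand. -/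
def virtualTorusDiagram (p q n : ℕ) : Diagram where
  word := closure p (virtualTorusBraid p q n)
  closed := joins_closure p q n

/-- The virtual torus link `VT^n_{p,q}`; it is a knot when `p` and `q` are coprime. -/
def VT (p q n : ℕ) : VirtualLink := (virtualTorusDiagram p q n).toLink

end VirtualKnot

/-! Write `p = n + 1` and `q = m + 1`, so that `m * n` classical crossings remain, all positive.
Both bounds equal `m * n / 2`.

Lower bound. The strands of a diagram carry integer labels as for the affine index polynomial: at a
classical crossing each label changes by one, on opposite sides in opposite directions, and at a
virtual crossing nothing changes. The labels do not see which strand is over. The difference of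
labels at a crossing is its index. The sum of the signs of the crossings of nonzero index is
invariant: a kink has index zero, the two crossings of an R2 bigon cancel, and the other moves
preserve signs and indices (`LocalMove.sameColors`). A crossing change keeps the labelling and
alters the sum by at most 2, and for the unknot the sum is 0, so half its absolute value bounds the
number of crossing changes (`UnknotsIn.abs_weight_le`). On the virtual torus knot an explicit
labelling gives every classical crossing a nonzero index, so the sum is `m * n` (`mem_weights_VT`).

Upper bound. Cut the knot at the closure and number the `p` strands by `height`, in the order in
which the knot meets them after the virtual strand. Change the crossings so that earlier strands lie
above later ones. The leftmost strand of a pass has to give way to exactly the strands of smaller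
height, so the pass costs its height; the heights of the passes pair up to `p - 1`, and the total is
`m * n / 2` (`exists_flips_torus_passes`, `sum_height`). The resulting layered braid closes to the
unknot: its top strand is pulled off, carried around the closure and past the virtual strand, and
then a Markov destabilization at a virtual crossing removes one strand
(`Layered.closure_equivalent`). -/

namespace VirtualKnot

/-! ### Index labellings of diagrams -/

/-- An orientation (upward is `1`) and an integer label of a strand. -/
abbrev Label := ℤˣ × ℤ

def Crossing.sign : Crossing → ℤ
  | pos => 1
  | neg => -1
  | virt => 0

/-- By how much the labels of two upward strands change at a crossing. -/
def Crossing.jump : Crossing → ℤ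
  | virt => 0
  | _ => 1

/-- The sign of a crossing if its index is not zero, for strands with orientations `o` and `o'`
whose labels below the crossing differ by `d`. -/
def weight (c : Crossing) (o o' : ℤˣ) (d : ℤ) : ℤ :=
  c.sign * (o * o') * if 2 * d + o + o' = 0 then 0 else 1

/-- The labellings of an elementary piece without strands to its left: labels on the line below
it, labels on the line above it, and the weight. -/
def Kind.Colors : Kind → List Label → List Label → ℤ → Prop
  | cup, s, t, n => ∃ o a, t = (o, a) :: (-o, a) :: s ∧ n = 0
  | cap, s, t, n => ∃ o a, s = (o, a) :: (-o, a) :: t ∧ n = 0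
  | cross c, s, t, n => ∃ (o o' : ℤˣ) (a a' : ℤ) (r : List Label), s = (o, a) :: (o', a') :: r ∧
      t = (o', a' - c.jump * o) :: (o, a + c.jump * o') :: r ∧ n = weight c o o' (a - a')

def Kind.ColorsAt (k : Kind) : ℕ → List Label → List Label → ℤ → Prop
  | 0, s, t, n => k.Colors s t n
  | i + 1, s, t, n => ∃ x s' t', s = x :: s' ∧ t = x :: t' ∧ k.ColorsAt i s' t' n

/-- `w` has a labelling of total weight `n` with labels `s` at the bottom and `t` at the top. -/
def Colored : List Piece → List Label → List Label → ℤ → Prop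
  | [], s, t, n => s = t ∧ n = 0
  | x :: w, s, t, n => ∃ s' m, x.kind.ColorsAt x.place s s' m ∧ Colored w s' t (n - m)

theorem colored_append {u v : List Piece} {s t : List Label} {n : ℤ} :
    Colored (u ++ v) s t n ↔ ∃ s' m, Colored u s s' m ∧ Colored v s' t (n - m) := by
  induction u generalizing s n with
  | nil => simp [Colored]
  | cons x u ih =>
    simp only [List.cons_append, Colored, ih]
    constructor
    · rintro ⟨s', m, h, s'', m', h', h''⟩
      exact ⟨s'', m + m', ⟨s', m, h, by simpa using h'⟩, by rwa [← sub_sub]⟩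
    · rintro ⟨s'', m', ⟨s', m, h, h'⟩, h''⟩
      exact ⟨s', m, h, s'', m' - m, h', by simpa using h''⟩

theorem Colored.trans {u v : List Piece} {s t r : List Label} {m n : ℤ} (hu : Colored u s t m)
    (hv : Colored v t r n) : Colored (u ++ v) s r (m + n) :=
  colored_append.2 ⟨t, m, hu, by simpa using hv⟩

def Piece.shift (i : ℕ) (x : Piece) : Piece := ⟨x.kind, x.place + i⟩

theorem colored_map_shift_succ {w : List Piece} {i : ℕ} {x : Label} {s t : List Label} {n : ℤ} :
    Colored (w.map (Piece.shift (i + 1))) (x :: s) t n ↔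
      ∃ t', t = x :: t' ∧ Colored (w.map (Piece.shift i)) s t' n := by
  induction w generalizing s n with
  | nil =>
    simp only [List.map_nil, Colored]
    exact ⟨fun ⟨h, h'⟩ => ⟨s, h.symm, rfl, h'⟩, fun ⟨t', h, h', h''⟩ => ⟨by rw [h, h'], h''⟩⟩
  | cons y w ih =>
    simp only [List.map_cons, Colored]
    constructor
    · rintro ⟨s', m, ⟨z, s₁, s₂, h₁, rfl, h⟩, h'⟩
      cases h₁
      obtain ⟨t', rfl, ht⟩ := ih.1 h'
      exact ⟨t', rfl, s₂, m, h, ht⟩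
    · rintro ⟨t', rfl, s', m, h, h'⟩
      exact ⟨_, m, ⟨x, s, s', rfl, rfl, h⟩, ih.2 ⟨t', rfl, h'⟩⟩

/-- The words have the same labellings, if there are at least `k` strands below. -/
def SameColors (k : ℕ) (u v : List Piece) : Prop :=
  ∀ s t n, k ≤ s.length → (Colored u s t n ↔ Colored v s t n)

/-- Strands to the left of a move keep their labels, so each move needs to be checked only at its
leftmost position. -/
theorem SameColors.shift {k : ℕ} {u v : List Piece} (h : SameColors k u v) (i : ℕ) :
    SameColors (k + i) (u.map (Piece.shift i)) (v.map (Piece.shift i)) := by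
  induction i with
  | zero =>
    have : Piece.shift 0 = id := rfl
    simpa [this] using h
  | succ i ih =>
    rintro (_ | ⟨x, s⟩) t n hs
    · simp at hs
    · simp only [colored_map_shift_succ]
      have := fun t' => ih s t' n (by simpa [← add_assoc] using hs)
      simp only [this]

@[simp] theorem colored_nil {s t : List Label} {n : ℤ} : Colored [] s t n ↔ s = t ∧ n = 0 :=
  Iff.rfl

@[simp] theorem colored_cross_zero {c : Crossing} {w : List Piece} {r t : List Label}
    {o o' : ℤˣ} {a a' n : ℤ} : Colored (cross c 0 :: w) ((o, a) :: (o', a') :: r) t n ↔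
      Colored w ((o', a' - c.jump * o) :: (o, a + c.jump * o') :: r) t
        (n - weight c o o' (a - a')) := by
  simp only [Colored, cross, Kind.ColorsAt, Kind.Colors]
  constructor
  · rintro ⟨s', m, ⟨o, o', a, a', r, h, rfl, rfl⟩, h'⟩
    simp_all
  · exact fun h => ⟨_, _, ⟨o, o', a, a', r, rfl, rfl, rfl⟩, h⟩

@[simp] theorem not_colored_cross_zero_nil {c : Crossing} {w : List Piece} {t : List Label}
    {n : ℤ} : ¬ Colored (cross c 0 :: w) [] t n := by
  simp [Colored, cross, Kind.ColorsAt, Kind.Colors]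

@[simp] theorem not_colored_cross_zero_singleton {c : Crossing} {w : List Piece} {x : Label}
    {t : List Label} {n : ℤ} : ¬ Colored (cross c 0 :: w) [x] t n := by
  simp [Colored, cross, Kind.ColorsAt, Kind.Colors]

@[simp] theorem colored_cup_zero {w : List Piece} {s t : List Label} {n : ℤ} :
    Colored (cup 0 :: w) s t n ↔ ∃ o a, Colored w ((o, a) :: (-o, a) :: s) t n := by
  simp only [Colored, cup, Kind.ColorsAt, Kind.Colors]
  constructor
  · rintro ⟨s', m, ⟨o, a, rfl, rfl⟩, h⟩
    exact ⟨o, a, by simpa using h⟩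
  · rintro ⟨o, a, h⟩
    exact ⟨_, 0, ⟨o, a, rfl, rfl⟩, by simpa using h⟩

@[simp] theorem colored_cap_zero {w : List Piece} {s t : List Label} {n : ℤ}
    {o o' : ℤˣ} {a a' : ℤ} : Colored (cap 0 :: w) ((o, a) :: (o', a') :: s) t n ↔
      o' = -o ∧ a' = a ∧ Colored w s t n := by
  simp only [Colored, cap, Kind.ColorsAt, Kind.Colors]
  constructor
  · rintro ⟨s', m, ⟨o, a, h, rfl⟩, h'⟩
    simp_all
  · rintro ⟨rfl, rfl, h⟩
    exact ⟨_, 0, ⟨_, _, rfl, rfl⟩, by simpa using h⟩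

@[simp] theorem not_colored_cap_zero_nil {w : List Piece} {t : List Label}
    {n : ℤ} : ¬ Colored (cap 0 :: w) [] t n := by
  simp [Colored, cap, Kind.ColorsAt, Kind.Colors]

@[simp] theorem not_colored_cap_zero_singleton {w : List Piece} {x : Label}
    {t : List Label} {n : ℤ} : ¬ Colored (cap 0 :: w) [x] t n := by
  simp [Colored, cap, Kind.ColorsAt, Kind.Colors]

@[simp] theorem colored_cross_one {c : Crossing} {w : List Piece} {x : Label} {r t : List Label}
    {o o' : ℤˣ} {a a' n : ℤ} : Colored (cross c 1 :: w) (x :: (o, a) :: (o', a') :: r) t n ↔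
      Colored w (x :: (o', a' - c.jump * o) :: (o, a + c.jump * o') :: r) t
        (n - weight c o o' (a - a')) := by
  simp only [Colored, cross, Kind.ColorsAt, Kind.Colors]
  constructor
  · rintro ⟨s', m, ⟨x, _, _, h, rfl, o, o', a, a', r, rfl, rfl, rfl⟩, h'⟩
    simp_all
  · exact fun h => ⟨_, _, ⟨_, _, _, rfl, rfl, o, o', a, a', r, rfl, rfl, rfl⟩, h⟩

@[simp] theorem not_colored_cross_one_nil {c : Crossing} {w : List Piece} {t : List Label}
    {n : ℤ} : ¬ Colored (cross c 1 :: w) [] t n := by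
  simp [Colored, cross, Kind.ColorsAt, Kind.Colors]

@[simp] theorem not_colored_cross_one_singleton {c : Crossing} {w : List Piece} {x : Label}
    {t : List Label} {n : ℤ} : ¬ Colored (cross c 1 :: w) [x] t n := by
  simp [Colored, cross, Kind.ColorsAt, Kind.Colors]

@[simp] theorem not_colored_cross_one_pair {c : Crossing} {w : List Piece} {x y : Label}
    {t : List Label} {n : ℤ} : ¬ Colored (cross c 1 :: w) [x, y] t n := by
  simp [Colored, cross, Kind.ColorsAt, Kind.Colors]

@[simp] theorem colored_cup_one {w : List Piece} {x : Label} {s t : List Label} {n : ℤ} :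
    Colored (cup 1 :: w) (x :: s) t n ↔ ∃ o a, Colored w (x :: (o, a) :: (-o, a) :: s) t n := by
  simp only [Colored, cup, Kind.ColorsAt, Kind.Colors]
  constructor
  · rintro ⟨s', m, ⟨x, _, _, h, rfl, o, a, rfl, rfl⟩, h'⟩
    cases h
    exact ⟨o, a, by simpa using h'⟩
  · rintro ⟨o, a, h⟩
    exact ⟨_, 0, ⟨_, _, _, rfl, rfl, o, a, rfl, rfl⟩, by simpa using h⟩

@[simp] theorem not_colored_cup_one_nil {w : List Piece} {t : List Label} {n : ℤ} :
    ¬ Colored (cup 1 :: w) [] t n := by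
  simp [Colored, cup, Kind.ColorsAt, Kind.Colors]

@[simp] theorem colored_cap_one {w : List Piece} {x : Label} {s t : List Label} {n : ℤ}
    {o o' : ℤˣ} {a a' : ℤ} : Colored (cap 1 :: w) (x :: (o, a) :: (o', a') :: s) t n ↔
      o' = -o ∧ a' = a ∧ Colored w (x :: s) t n := by
  simp only [Colored, cap, Kind.ColorsAt, Kind.Colors]
  constructor
  · rintro ⟨s', m, ⟨x, _, _, h, rfl, o, a, rfl, rfl⟩, h'⟩
    simp_all
  · rintro ⟨rfl, rfl, h⟩
    exact ⟨_, 0, ⟨_, _, _, rfl, rfl, _, _, rfl, rfl⟩, by simpa using h⟩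

@[simp] theorem not_colored_cap_one_pair {w : List Piece} {x y : Label} {t : List Label}
    {n : ℤ} : ¬ Colored (cap 1 :: w) [x, y] t n := by
  simp [Colored, cap, Kind.ColorsAt, Kind.Colors]

/-! ### Invariance of the labellings under the local moves -/

theorem jump_flip (c : Crossing) : c.flip.jump = c.jump := by cases c <;> rfl

theorem sign_flip (c : Crossing) : c.flip.sign = -c.sign := by cases c <;> rfl

theorem jump_of_ne_virt {c : Crossing} (h : c ≠ .virt) : c.jump = 1 := by
  cases c <;> simp_all [Crossing.jump]

@[simp] theorem weight_virt (o o' : ℤˣ) (d : ℤ) : weight .virt o o' d = 0 := by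
  simp [weight, Crossing.sign]

/-- The number `2 * d + o + o'` is the sum of the label differences of the two strands below and
above a classical crossing. In an R2 bigon the strands enter the second crossing in exchanged order,
so this number changes sign, its vanishing is unaffected, and the two weights cancel. -/
theorem weight_flip (c : Crossing) (o o' : ℤˣ) {d d' : ℤ}
    (h : 2 * d' + o + o' = -(2 * d + o + o')) :
    weight c.flip o' o d' = -weight c o o' d := by
  have h' : 2 * d' + o' + o = -(2 * d + o + o') := by rw [← h]; ring
  simp only [weight, sign_flip, h', neg_eq_zero]
  ring

theorem weight_eq_zero (c : Crossing) {o o' : ℤˣ} {d : ℤ} (h : 2 * d + o + o' = 0) :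
    weight c o o' d = 0 := by
  simp [weight, h]

/-- Labels ignore over and under, so all classical types can be treated at once. When two strands
meet, the third has either crossed neither or shifted both labels equally. Hence each pair meets
with the same label difference on both sides of the move. -/
theorem sameColors_r3 {a b c : Crossing} (ha : a.jump = 1) (hb : b.jump = 1) (hc : c.jump = 1) :
    SameColors 0 [cross a 0, cross b 1, cross c 0] [cross c 1, cross b 0, cross a 1] := by
  rintro (_ | ⟨⟨o, x⟩, _ | ⟨⟨o', x'⟩, _ | ⟨⟨o'', x''⟩, r⟩⟩⟩) t n -
  · simp
  · simp
  · simp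
  · have h₁ : x'' - o - o' = x'' - o' - (o : ℤ) := by ring
    have h₂ : x' - o + o'' = x' + o'' - (o : ℤ) := by ring
    have h₃ : x + o' + o'' = x + o'' + (o' : ℤ) := by ring
    have h₄ : x - (x'' - o') = x + o' - x'' := by ring
    simp only [colored_cross_zero, colored_cross_one, colored_nil, ha, hb, hc, one_mul, h₁, h₂, h₃,
      h₄, add_sub_add_right_eq_sub, sub_sub_sub_cancel_right, sub_right_comm _ (weight c _ _ _),
      sub_right_comm _ (weight b _ _ _) (weight a _ _ _)]

theorem sameColors_vr3 : SameColors 0 [cross .virt 0, cross .virt 1, cross .virt 0]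
    [cross .virt 1, cross .virt 0, cross .virt 1] := by
  rintro (_ | ⟨⟨o, a⟩, _ | ⟨⟨o', a'⟩, _ | ⟨⟨o'', a''⟩, r⟩⟩⟩) t n - <;> simp [Crossing.jump]

theorem sameColors_mr_first (c : Crossing) : SameColors 0
    [cross c 0, cross .virt 1, cross .virt 0] [cross .virt 1, cross .virt 0, cross c 1] := by
  rintro (_ | ⟨⟨o, a⟩, _ | ⟨⟨o', a'⟩, _ | ⟨⟨o'', a''⟩, r⟩⟩⟩) t n - <;> simp [Crossing.jump]

theorem sameColors_mr_second (c : Crossing) : SameColors 0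
    [cross .virt 0, cross c 1, cross .virt 0] [cross .virt 1, cross c 0, cross .virt 1] := by
  rintro (_ | ⟨⟨o, a⟩, _ | ⟨⟨o', a'⟩, _ | ⟨⟨o'', a''⟩, r⟩⟩⟩) t n - <;> simp [Crossing.jump]

theorem sameColors_mr_third (c : Crossing) : SameColors 0
    [cross .virt 0, cross .virt 1, cross c 0] [cross c 1, cross .virt 0, cross .virt 1] := by
  rintro (_ | ⟨⟨o, a⟩, _ | ⟨⟨o', a'⟩, _ | ⟨⟨o'', a''⟩, r⟩⟩⟩) t n - <;> simp [Crossing.jump]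

theorem sameColors_r2 (c : Crossing) : SameColors 2 [cross c 0, cross c.flip 0] [] := by
  rintro (_ | ⟨⟨o, a⟩, _ | ⟨⟨o', a'⟩, r⟩⟩) t n hs
  · simp at hs
  · simp at hs
  · have h : weight c.flip o' o (a' - c.jump * o - (a + c.jump * o')) =
        -weight c o o' (a - a') := by
      cases c
      · exact weight_flip _ _ _ (by simp [Crossing.jump]; ring)
      · exact weight_flip _ _ _ (by simp [Crossing.jump]; ring)
      · simp [Crossing.flip]
    simp [jump_flip, h]

/-- The two ends at the kink have equal labels and opposite orientations, so the index is zero; this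
is why `weight` discards such crossings. The witnesses are the labels after the two ends have been
exchanged by the crossing. -/
theorem sameColors_r1_cup (c : Crossing) : SameColors 0 [cup 0, cross c 0] [cup 0] := by
  rintro s t n -
  simp only [colored_cup_zero, colored_cross_zero, colored_nil]
  constructor
  · rintro ⟨o, a, rfl, h⟩
    rw [sub_self, weight_eq_zero _ (by simp), sub_zero] at h
    exact ⟨-o, a - c.jump * o, by simp [sub_eq_add_neg], h⟩
  · rintro ⟨o, a, rfl, h⟩
    refine ⟨-o, a - c.jump * o, by simp [sub_eq_add_neg], ?_⟩
    rw [sub_self, weight_eq_zero _ (by simp), sub_zero, h]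

theorem sameColors_r1_cap (c : Crossing) : SameColors 0 [cross c 0, cap 0] [cap 0] := by
  rintro (_ | ⟨⟨o, a⟩, _ | ⟨⟨o', a'⟩, r⟩⟩) t n -
  · simp
  · simp
  · simp only [colored_cap_zero, colored_cross_zero, colored_nil]
    constructor
    · rintro ⟨rfl, h, rfl, h'⟩
      have : a' = a := by rw [Units.val_neg] at h; linarith
      subst this
      rw [sub_self, weight_eq_zero _ (by simp), sub_zero] at h'
      simp [h']
    · rintro ⟨rfl, rfl, rfl, rfl⟩
      rw [sub_self, weight_eq_zero _ (by simp)]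
      simp [sub_eq_add_neg]

/-- Sliding a crossing through an extremum reverses one strand and exchanges the roles of `pos` and
`neg`; the two changes of sign compensate. -/
theorem weight_flip_neg_left (c : Crossing) (o o' : ℤˣ) {d d' : ℤ}
    (h : 2 * d' - o' + o = -(2 * d + o + o')) : weight c.flip (-o') o d' = weight c o o' d := by
  simp only [weight, sign_flip, Units.val_neg, ← sub_eq_add_neg, h, neg_eq_zero]
  ring

theorem weight_flip_neg_right (c : Crossing) (o o' : ℤˣ) {d d' : ℤ}
    (h : 2 * d' + o' - o = -(2 * d + o + o')) : weight c.flip o' (-o) d' = weight c o o' d := by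
  simp only [weight, sign_flip, Units.val_neg, ← sub_eq_add_neg, h, neg_eq_zero]
  ring

theorem sameColors_slide_cup (c : Crossing) :
    SameColors 0 [cup 1, cross c 0] [cup 0, cross c.flip 1] := by
  rintro (_ | ⟨⟨o, a⟩, r⟩) t n -
  · simp
  · simp only [colored_cup_zero, colored_cup_one, colored_cross_zero, colored_cross_one,
      colored_nil, jump_flip]
    have key (o' : ℤˣ) (b : ℤ) :
        weight c.flip (-o') o (b - c.jump * o - a) = weight c o o' (a - b) := by
      cases c
      · exact weight_flip_neg_left _ _ _ (by simp [Crossing.jump]; ring)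
      · exact weight_flip_neg_left _ _ _ (by simp [Crossing.jump]; ring)
      · simp [Crossing.flip]
    constructor
    · rintro ⟨o', b, rfl, h⟩
      exact ⟨o', b - c.jump * o, by simp, by rwa [key]⟩
    · rintro ⟨o', b, rfl, h⟩
      refine ⟨o', b + c.jump * o, by simp, ?_⟩
      rwa [← key, add_sub_cancel_right]

theorem sameColors_slide_cap (c : Crossing) :
    SameColors 0 [cross c 0, cap 1] [cross c.flip 1, cap 0] := by
  rintro (_ | ⟨⟨o, a⟩, _ | ⟨⟨o', a'⟩, _ | ⟨⟨o'', a''⟩, r⟩⟩⟩) t n -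
  · simp
  · simp
  · simp
  · simp only [colored_cap_zero, colored_cap_one, colored_cross_zero, colored_cross_one,
      colored_nil, jump_flip, sub_eq_iff_eq_add]
    refine and_congr_right ?_
    rintro rfl
    refine and_congr_right ?_
    rintro rfl
    have key : weight c.flip o' (-o) (a' - (a + c.jump * o')) = weight c o o' (a - a') := by
      cases c
      · exact weight_flip_neg_right _ _ _ (by simp [Crossing.jump]; ring)
      · exact weight_flip_neg_right _ _ _ (by simp [Crossing.jump]; ring)
      · simp [Crossing.flip]
    rw [key]
    simp [sub_eq_add_neg]

theorem sameColors_exchange (x y : Kind) (d : ℕ) :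
    SameColors 0 [⟨x, 0⟩, ⟨y, d + x.top⟩] [⟨y, d + x.bottom⟩, ⟨x, 0⟩] := by
  rintro s t n -
  simp only [Colored, Kind.ColorsAt]
  cases x with
  | cup =>
    simp only [Kind.top, Kind.bottom, Kind.ColorsAt, Kind.Colors]
    constructor
    · rintro ⟨_, _, ⟨o, a, rfl, rfl⟩, _, m, ⟨_, _, _, h, rfl, _, _, _, h', rfl, hy⟩, rfl, h₀⟩
      cases h; cases h'
      exact ⟨_, m, hy, _, _, ⟨o, a, rfl, rfl⟩, rfl, by linarith⟩
    · rintro ⟨_, m, hy, _, _, ⟨o, a, rfl, rfl⟩, rfl, h₀⟩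
      exact ⟨_, _, ⟨o, a, rfl, rfl⟩, _, m, ⟨_, _, _, rfl, rfl, _, _, _, rfl, rfl, hy⟩, rfl,
        by linarith⟩
  | cap =>
    simp only [Kind.top, Kind.bottom, Kind.ColorsAt, Kind.Colors]
    constructor
    · rintro ⟨_, _, ⟨o, a, rfl, rfl⟩, _, m, hy, rfl, h₀⟩
      exact ⟨_, m, ⟨_, _, _, rfl, rfl, _, _, _, rfl, rfl, hy⟩, _, _, ⟨o, a, rfl, rfl⟩, rfl,
        by linarith⟩
    · rintro ⟨_, m, ⟨_, _, _, rfl, rfl, _, _, _, rfl, rfl, hy⟩, _, _, ⟨o, a, h, rfl⟩, rfl, h₀⟩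
      cases h
      exact ⟨_, _, ⟨o, a, rfl, rfl⟩, _, m, hy, rfl, by linarith⟩
  | cross c =>
    simp only [Kind.top, Kind.bottom, Kind.ColorsAt, Kind.Colors]
    constructor
    · rintro ⟨_, _, ⟨o, o', a, a', r, rfl, rfl, rfl⟩, _, m,
        ⟨_, _, _, h, rfl, _, _, _, h', rfl, hy⟩, rfl, h₀⟩
      cases h; cases h'
      exact ⟨_, m, ⟨_, _, _, rfl, rfl, _, _, _, rfl, rfl, hy⟩, _, _,
        ⟨o, o', a, a', _, rfl, rfl, rfl⟩, rfl, by linarith⟩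
    · rintro ⟨_, m, ⟨_, _, _, rfl, rfl, _, _, _, rfl, rfl, hy⟩, _, _,
        ⟨o, o', a, a', r, h, rfl, rfl⟩, rfl, h₀⟩
      cases h
      exact ⟨_, _, ⟨o, o', a, a', _, rfl, rfl, rfl⟩, _, m,
        ⟨_, _, _, rfl, rfl, _, _, _, rfl, rfl, hy⟩, rfl, by linarith⟩

theorem sameColors_zigzag_right : SameColors 1 [cup 0, cap 1] [] := by
  rintro (_ | ⟨⟨o, a⟩, r⟩) t n hs
  · simp at hs
  · simp

theorem sameColors_zigzag_left : SameColors 1 [cup 1, cap 0] [] := by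
  rintro (_ | ⟨⟨o, a⟩, r⟩) t n hs
  · simp at hs
  · simp

theorem LocalMove.sameColors {u v : List Piece} (h : LocalMove u v) {k m : ℕ}
    (hu : Joins u k m) : SameColors k u v := by
  have lift {i j : ℕ} {a b : List Piece} (hab : SameColors j a b) (ha : u = a.map (Piece.shift i))
      (hb : v = b.map (Piece.shift i)) (hj : j + i ≤ k) : SameColors k u v := by
    subst ha hb
    exact fun s t n hs => hab.shift i s t n (hj.trans hs)
  have place_le : ∀ {x w}, u = x :: w → x.place + x.kind.bottom ≤ k := by
    rintro x w rfl
    obtain ⟨l, ⟨r, h, -⟩, -⟩ := hu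
    omega
  -- For `zigzag_right` the minimum alone does not force a strand to its right; only the maximum
  -- that follows does.
  have zigzag_le : ∀ {x y w}, u = x :: y :: w →
      y.place + y.kind.bottom + x.kind.bottom ≤ k + x.kind.top := by
    rintro x y w rfl
    obtain ⟨l, ⟨r, h, h'⟩, l', ⟨r', h'', -⟩, -⟩ := hu
    omega
  cases h with
  | exchange x y i d =>
    have := place_le rfl
    refine lift (i := i) (sameColors_exchange x y d) ?_ ?_ (by simp at this; omega) <;>
    · simp [Piece.shift]; omega
  | zigzag_right i =>
    have := zigzag_le rfl
    refine lift (i := i) sameColors_zigzag_right ?_ ?_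
      (by simp [cup, cap, Kind.top, Kind.bottom] at this; omega) <;>
    simp [Piece.shift, cup, cap, add_comm]
  | zigzag_left i =>
    have := place_le rfl
    refine lift (i := i) sameColors_zigzag_left ?_ ?_
      (by simp [cup, Kind.bottom] at this; omega) <;>
    simp [Piece.shift, cup, cap, add_comm]
  | slide_cup c i =>
    have := place_le rfl
    refine lift (i := i) (sameColors_slide_cup c) ?_ ?_
      (by simp [cup, Kind.bottom] at this; omega) <;>
    simp [Piece.shift, cup, cross, add_comm]
  | slide_cap c i =>
    have := place_le rfl
    refine lift (i := i) (sameColors_slide_cap c) ?_ ?_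
      (by simp [cross, Kind.bottom] at this; omega) <;>
    simp [Piece.shift, cap, cross, add_comm]
  | r1_cup c i =>
    have := place_le rfl
    refine lift (i := i) (sameColors_r1_cup c) ?_ ?_
      (by simp [cup, Kind.bottom] at this; omega) <;>
    simp [Piece.shift, cup, cross]
  | r1_cap c i =>
    have := place_le rfl
    refine lift (i := i) (sameColors_r1_cap c) ?_ ?_
      (by simp [cross, Kind.bottom] at this; omega) <;>
    simp [Piece.shift, cap, cross]
  | r2 c i =>
    have := place_le rfl
    refine lift (i := i) (sameColors_r2 c) ?_ ?_
      (by simp [cross, Kind.bottom] at this; omega) <;>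
    simp [Piece.shift, cross]
  | r3 a b c i ha hb hc h =>
    have := place_le rfl
    refine lift (i := i) (sameColors_r3 (jump_of_ne_virt ha) (jump_of_ne_virt hb)
      (jump_of_ne_virt hc)) ?_ ?_ (by simp [cross, Kind.bottom] at this; omega) <;>
    simp [Piece.shift, cross, add_comm]
  | vr3 i =>
    have := place_le rfl
    refine lift (i := i) sameColors_vr3 ?_ ?_
      (by simp [cross, Kind.bottom] at this; omega) <;>
    simp [Piece.shift, cross, add_comm]
  | mr_first c i hc =>
    have := place_le rfl
    refine lift (i := i) (sameColors_mr_first c) ?_ ?_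
      (by simp [cross, Kind.bottom] at this; omega) <;>
    simp [Piece.shift, cross, add_comm]
  | mr_second c i hc =>
    have := place_le rfl
    refine lift (i := i) (sameColors_mr_second c) ?_ ?_
      (by simp [cross, Kind.bottom] at this; omega) <;>
    simp [Piece.shift, cross, add_comm]
  | mr_third c i hc =>
    have := place_le rfl
    refine lift (i := i) (sameColors_mr_third c) ?_ ?_
      (by simp [cross, Kind.bottom] at this; omega) <;>
    simp [Piece.shift, cross, add_comm]

/-! ### Total weights of virtual links and the lower bound -/

theorem Kind.ColorsAt.joins {k : Kind} {i : ℕ} {s t : List Label} {n : ℤ}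
    (h : k.ColorsAt i s t n) : Piece.Joins ⟨k, i⟩ s.length t.length := by
  induction i generalizing s t with
  | zero =>
    cases k with
    | cup =>
      obtain ⟨o, a, rfl, -⟩ := h
      exact ⟨s.length, by simp [Kind.bottom, Kind.top]; omega⟩
    | cap =>
      obtain ⟨o, a, rfl, -⟩ := h
      exact ⟨t.length, by simp [Kind.bottom, Kind.top]; omega⟩
    | cross c =>
      obtain ⟨o, o', a, a', r, rfl, rfl, -⟩ := h
      exact ⟨r.length, by simp [Kind.bottom, Kind.top]; omega⟩
  | succ i ih =>
    obtain ⟨x, s', t', rfl, rfl, h⟩ := h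
    obtain ⟨r, h₁, h₂⟩ := ih h
    exact ⟨r, by simp at *; omega⟩

theorem Colored.joins {w : List Piece} {s t : List Label} {n : ℤ} (h : Colored w s t n) :
    Joins w s.length t.length := by
  induction w generalizing s n with
  | nil => rw [h.1]; rfl
  | cons x w ih =>
    obtain ⟨s', m, hx, hw⟩ := h
    exact ⟨_, hx.joins, ih hw⟩

theorem joins_append_iff {u v : List Piece} {n m : ℕ} :
    Joins (u ++ v) n m ↔ ∃ l, Joins u n l ∧ Joins v l m := by
  refine ⟨fun h => ?_, fun ⟨l, hu, hv⟩ => joins_append hu hv⟩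
  induction u generalizing n with
  | nil => exact ⟨n, rfl, h⟩
  | cons x u ih =>
    obtain ⟨k, hx, hk⟩ := h
    obtain ⟨l, hu, hv⟩ := ih hk
    exact ⟨l, ⟨k, hx, hu⟩, hv⟩

theorem Joins.unique {w : List Piece} {n m m' : ℕ} (h : Joins w n m) (h' : Joins w n m') :
    m = m' := by
  induction w generalizing n with
  | nil => exact Eq.trans (Eq.symm h) h'
  | cons x w ih =>
    obtain ⟨l, ⟨r, h₁, h₂⟩, h⟩ := h
    obtain ⟨l', ⟨r', h₁', h₂'⟩, h'⟩ := h'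
    obtain rfl : l = l' := by omega
    exact ih h h'

/-- The total weights of the labellings of a diagram. -/
def Diagram.weights (D : Diagram) : Set ℤ := {n | Colored D.word [] [] n}

theorem Diagram.Move.weights_eq {D E : Diagram} (h : D.Move E) : D.weights = E.weights := by
  obtain ⟨u, v, a, b, hab, hD, hE⟩ := h
  -- The words before and after the move agree in labellings only when enough strands lie below;
  -- their number is determined by `u`.
  have hDc := D.closed
  rw [hD] at hDc
  obtain ⟨m, hm, -⟩ := joins_append_iff.1 hDc
  obtain ⟨l, hu, ha⟩ := joins_append_iff.1 hm
  ext n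
  simp only [Diagram.weights, hD, hE, Set.mem_ofPred_eq, colored_append]
  refine exists_congr fun t => exists_congr fun m' => and_congr_left fun _ =>
    exists_congr fun s => exists_congr fun m'' => and_congr_right fun hs => ?_
  exact hab.sameColors ha _ _ _ (hu.unique hs.joins).le

/-- Taking all total weights at once requires neither a choice of labelling nor a proof that one
exists or that the total is unique. -/
def VirtualLink.weights : VirtualLink → Set ℤ :=
  Quot.lift Diagram.weights fun _ _ h => h.weights_eq

theorem abs_weight_le (c : Crossing) (o o' : ℤˣ) (d : ℤ) : |weight c o o' d| ≤ 1 := by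
  have h (u : ℤˣ) : |(u : ℤ)| = 1 := by rcases Int.units_eq_one_or u with rfl | rfl <;> simp
  unfold weight
  rw [abs_mul, abs_mul, abs_mul, h, h]
  split_ifs <;> cases c <;> simp [Crossing.sign]

/-- The same labels fit the changed crossing, since both classical types have the same jump. Only
the weight changes, within `[-1, 1]`. -/
theorem Kind.ColorsAt.flip {c : Crossing} {i : ℕ} {s t : List Label} {n : ℤ}
    (h : (Kind.cross c).ColorsAt i s t n) :
    ∃ m, |n - m| ≤ 2 ∧ (Kind.cross c.flip).ColorsAt i s t m := by
  induction i generalizing s t with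
  | zero =>
    obtain ⟨o, o', a, a', r, rfl, rfl, rfl⟩ := h
    refine ⟨_, ?_, o, o', a, a', r, rfl, by rw [jump_flip], rfl⟩
    have h₁ := abs_weight_le c o o' (a - a')
    have h₂ := abs_weight_le c.flip o o' (a - a')
    rw [abs_le] at *
    constructor <;> linarith
  | succ i ih =>
    obtain ⟨x, s', t', rfl, rfl, h⟩ := h
    obtain ⟨m, hm, h⟩ := ih h
    exact ⟨m, hm, x, s', t', rfl, rfl, h⟩

theorem VirtualLink.CrossingChange.exists_weight {K L : VirtualLink} (h : K.CrossingChange L)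
    {n : ℤ} (hn : n ∈ K.weights) : ∃ m ∈ L.weights, |n - m| ≤ 2 := by
  obtain ⟨D, E, rfl, rfl, u, v, c, i, -, hD, hE⟩ := h
  change Colored D.word [] [] n at hn
  change ∃ m, Colored E.word [] [] m ∧ _
  rw [hD] at hn
  rw [hE]
  obtain ⟨t, m₁, hn, hv⟩ := colored_append.1 hn
  obtain ⟨s, m₂, hu, s', m₃, hc, rfl, hm⟩ := colored_append.1 hn
  obtain ⟨m, hm', hc'⟩ := Kind.ColorsAt.flip hc
  refine ⟨_, (hu.trans (v := [cross c.flip i]) (n := m) ⟨_, m, hc', rfl, by simp⟩).trans hv, ?_⟩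
  convert hm' using 2
  linarith

theorem weights_unknot {n : ℤ} (hn : n ∈ unknot.weights) : n = 0 := by
  change Colored [cup 0, cap 0] [] [] n at hn
  simpa using hn

/-- Every total weight of a labelling bounds the unknotting number from below. -/
theorem UnknotsIn.abs_weight_le {k : ℕ} {K : VirtualLink} (h : UnknotsIn k K) {n : ℤ}
    (hn : n ∈ K.weights) : |n| ≤ 2 * k := by
  induction h generalizing n with
  | zero => simp [weights_unknot hn]
  | succ k K L h _ ih =>
    obtain ⟨m, hm, hnm⟩ := h.exists_weight hn
    have := ih hm
    have := abs_add_le (n - m) m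
    rw [sub_add_cancel] at this
    push_cast
    linarith

/-! ### The order of the strands along the torus knot -/

section Height

variable (p q : ℕ) [NeZero p]

/-- For the torus knot, the order in which the knot, from the virtual strand on, runs through
the strand that is the leftmost one before the classical pass number `j`. -/
def height (j : ℕ) : ℕ := (-((j : ZMod p) + 1) * (q : ZMod p)⁻¹).val

theorem height_lt (j : ℕ) : height p q j < p := ZMod.val_lt _

omit [NeZero p] in
theorem height_add_period (j : ℕ) : height p q (j + p) = height p q j := by
  simp [height]

omit [NeZero p] in
theorem height_of_add_one_eq {j : ℕ} (h : j + 1 = p) : height p q j = 0 := by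
  have : (j : ZMod p) + 1 = 0 := by
    have := ZMod.natCast_self p
    rw [← h] at this ⊢
    exact_mod_cast this
  simp [height, this]

variable {p q} (hpq : q.Coprime p)
include hpq

theorem height_injective {i j : ℕ} (h : height p q i = height p q j) : i ≡ j [MOD p] := by
  have h := ZMod.val_injective p h
  have hu : IsUnit (q : ZMod p)⁻¹ :=
    IsUnit.of_mul_eq_one _ (by rw [mul_comm]; exact ZMod.coe_mul_inv_eq_one q hpq)
  have h := hu.mul_right_cancel h
  rw [neg_inj, add_left_inj] at h
  exact (ZMod.natCast_eq_natCast_iff _ _ _).1 h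

/-- A full turn through all `q` passes shifts places by `q` modulo `p`, so from strand `j + q` the
knot continues to strand `j`. The excluded class `j ≡ -1` is the strand of height 0, where the
cyclic order starts. -/
theorem height_add {j : ℕ} (hj : ¬ p ∣ j + 1) :
    height p q j = height p q (j + q) + 1 := by
  have hq := ZMod.coe_mul_inv_eq_one q hpq
  have h : -((j : ZMod p) + 1) * (q : ZMod p)⁻¹ =
      -(((j + q : ℕ) : ZMod p) + 1) * (q : ZMod p)⁻¹ + 1 := by
    push_cast
    linear_combination hq
  have h0 : height p q j ≠ 0 := by
    intro h0
    apply hj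
    have hp : p - 1 + 1 = p := Nat.sub_add_cancel (NeZero.one_le)
    have := height_injective hpq (h0.trans (height_of_add_one_eq p q hp).symm)
    have := this.add_right 1
    rw [hp] at this
    exact Nat.modEq_zero_iff_dvd.1 (this.trans (by simp [Nat.ModEq]))
  have hp : 1 < p := by have := height_lt p q j; omega
  have : Fact (1 < p) := ⟨hp⟩
  unfold height at h0 ⊢
  rw [h, ZMod.val_add, ZMod.val_one] at h0 ⊢
  refine Nat.mod_eq_of_lt (lt_of_le_of_ne (ZMod.val_lt _) fun h' => h0 ?_)
  rw [h', Nat.mod_self]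

/-- Modulo `p` the two heights add up to `-(i + j + 2) / q = -1`. Since each lies in `[0, p - 1]`,
the left side is a multiple of `p` strictly between 0 and `2 * p`. -/
theorem height_add_height {i j : ℕ} (h : i + j + 2 ≡ q [MOD p]) :
    height p q i + height p q j + 1 = p := by
  have hq := ZMod.coe_mul_inv_eq_one q hpq
  have h := (ZMod.natCast_eq_natCast_iff _ _ _).2 h
  have h' : ((height p q i + height p q j + 1 : ℕ) : ZMod p) = 0 := by
    push_cast [height, ZMod.natCast_val, ZMod.cast_id]
    push_cast at h
    linear_combination -(q : ZMod p)⁻¹ * h - hq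
  obtain ⟨k, hk⟩ := (ZMod.natCast_eq_zero_iff _ _).1 h'
  have h₁ := height_lt p q i
  have h₂ := height_lt p q j
  have : k < 2 := by nlinarith
  interval_cases k <;> omega

/-- Pairing `m` with `q' - 1 - m` shows that the heights average to `(p - 1) / 2`. -/
theorem sum_height (q' : ℕ) (hq : q = q' + 1) :
    2 * ∑ m ∈ Finset.range q', height p q m = (p - 1) * q' := by
  have h : ∑ m ∈ Finset.range q', (height p q m + height p q (q' - 1 - m)) =
      ∑ m ∈ Finset.range q', (p - 1) := by
    refine Finset.sum_congr rfl fun m hm => ?_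
    rw [Finset.mem_range] at hm
    have := height_add_height hpq (i := m) (j := q' - 1 - m)
      (by rw [show m + (q' - 1 - m) + 2 = q by omega])
    omega
  rw [Finset.sum_add_distrib, Finset.sum_range_reflect (fun m => height p q m)] at h
  rw [two_mul, h]
  simp [mul_comm]

end Height

/-! ### A labelling of the virtual torus knot -/

theorem Kind.Colors.colorsAt {k : Kind} {s t : List Label} {n : ℤ} (h : k.Colors s t n)
    (l : List Label) : k.ColorsAt l.length (l ++ s) (l ++ t) n := by
  induction l with
  | nil => exact h
  | cons x l ih => exact ⟨x, _, _, rfl, rfl, ih⟩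

theorem Kind.ColorsAt.colored {k : Kind} {i : ℕ} {s t : List Label} {n : ℤ}
    (h : k.ColorsAt i s t n) : Colored [⟨k, i⟩] s t n :=
  ⟨t, n, h, rfl, sub_self n⟩

def Label.reverse (x : Label) : Label := (-x.1, x.2)

theorem colored_cups (l : List Label) :
    Colored ((List.range l.length).map cup) [] (l ++ (l.map Label.reverse).reverse) 0 := by
  induction l using List.reverseRecOn with
  | nil => simp
  | append_singleton l x ih =>
    simp only [List.length_append, List.length_singleton, List.range_succ, List.map_append]
    refine ih.trans (n := 0) ?_
    have : Kind.Colors .cup (l.map Label.reverse).reverse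
      (x :: x.reverse :: (l.map Label.reverse).reverse) 0 := ⟨x.1, x.2, rfl, rfl⟩
    simpa [cup] using (this.colorsAt l).colored

theorem colored_caps (l : List Label) :
    Colored ((List.range l.length).reverse.map cap) (l ++ (l.map Label.reverse).reverse) [] 0 := by
  induction l using List.reverseRecOn with
  | nil => simp
  | append_singleton l x ih =>
    simp only [List.length_append, List.length_singleton, List.range_succ, List.map_append,
      List.reverse_append]
    have : Kind.Colors .cap (x :: x.reverse :: (l.map Label.reverse).reverse)
      (l.map Label.reverse).reverse 0 := ⟨x.1, x.2, rfl, rfl⟩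
    simpa [cap] using (this.colorsAt l).colored.trans ih

/-- The list `r` stands for the returning strands, which the braid does not touch. They carry the
labels of `l` with reversed orientations. -/
theorem colored_closure {p : ℕ} {w : List Piece} {l : List Label} {n : ℤ} (hl : l.length = p)
    (h : ∀ r, Colored w (l ++ r) (l ++ r) n) : Colored (closure p w) [] [] n := by
  subst hl
  simpa [closure] using ((colored_cups l).trans (h _)).trans (colored_caps l)

def upward (a : ℤ) : Label := (1, a)

/-- At crossing number `k` the overstrand has reached the label `a + k`, so `h` says that the index
`a + k + 1 - l[k]` is nonzero and each crossing counts `+1`. -/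
theorem colored_pass_pos_aux (s : List Label) (a : ℤ) (l : List ℤ) (r : List Label)
    (h : ∀ (k : ℕ) (hk : k < l.length), a + k + 1 ≠ l[k]) :
    Colored ((List.range' s.length l.length).map (cross .pos))
      (s ++ upward a :: (l.map upward ++ r))
      (s ++ (l.map (fun b => upward (b - 1)) ++ upward (a + l.length) :: r)) l.length := by
  induction l generalizing s a with
  | nil => simp
  | cons b l ih =>
    have h₀ := h 0 (by simp)
    have hw : weight .pos 1 1 (a - b) = 1 := by
      simp only [Nat.cast_zero, add_zero, List.getElem_cons_zero] at h₀
      rw [weight, if_neg]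
      · simp [Crossing.sign]
      · simp only [Units.val_one]
        omega
    have hc : Kind.Colors (.cross .pos) (upward a :: upward b :: (l.map upward ++ r))
        (upward (b - 1) :: upward (a + 1) :: (l.map upward ++ r)) 1 :=
      ⟨1, 1, a, b, _, rfl, by simp [upward, Crossing.jump], hw.symm⟩
    have ih := ih (s ++ [upward (b - 1)]) (a + 1) fun k hk => by
      have := h (k + 1) (by simpa using hk)
      push_cast at this
      rw [List.getElem_cons_succ] at this
      rwa [add_assoc a, add_comm 1]
    simpa [List.range'_succ, cross, add_comm, add_left_comm, add_assoc] using
      (hc.colorsAt s).colored.trans (by simpa [add_assoc, add_comm (1 : ℤ)] using ih)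

theorem colored_pass_pos (a : ℤ) (l : List ℤ) (r : List Label)
    (h : ∀ (k : ℕ) (hk : k < l.length), a + k + 1 ≠ l[k]) :
    Colored (pass .pos (l.length + 1)) ((a :: l).map upward ++ r)
      ((l.map (· - 1) ++ [a + l.length]).map upward ++ r) l.length := by
  simpa [pass, List.range_eq_range', Function.comp_def] using colored_pass_pos_aux [] a l r h

theorem colored_pass_virt_aux (s : List Label) (a : ℤ) (l : List ℤ) (r : List Label) :
    Colored ((List.range' s.length l.length).map (cross .virt))
      (s ++ upward a :: (l.map upward ++ r)) (s ++ (l.map upward ++ upward a :: r)) 0 := by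
  induction l generalizing s with
  | nil => simp
  | cons b l ih =>
    have hc : Kind.Colors (.cross .virt) (upward a :: upward b :: (l.map upward ++ r))
        (upward b :: upward a :: (l.map upward ++ r)) 0 :=
      ⟨1, 1, a, b, _, rfl, by simp [upward, Crossing.jump], (weight_virt _ _ _).symm⟩
    have ih := ih (s ++ [upward b])
    simpa [List.range'_succ, cross] using
      (hc.colorsAt s).colored.trans (by simpa using ih)

theorem colored_pass_virt (a : ℤ) (l : List ℤ) (r : List Label) :
    Colored (pass .virt (l.length + 1)) ((a :: l).map upward ++ r)
      ((l ++ [a]).map upward ++ r) 0 := by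
  simpa [pass, List.range_eq_range', Function.comp_def] using colored_pass_virt_aux [] a l r

/-- The labels before the classical pass number `t` of a torus braid on `n + 1` strands. -/
def torusLabels (n q t : ℕ) : List ℤ :=
  (List.range (n + 1)).map fun j : ℕ => (j : ℤ) + height (n + 1) q (t + j)

theorem torusLabels_eq_cons (n q t : ℕ) : torusLabels n q t = (height (n + 1) q t : ℤ) ::
    (List.range n).map fun j : ℕ => (j : ℤ) + 1 + height (n + 1) q (t + j + 1) := by
  simp [torusLabels, List.range_succ_eq_map, Function.comp_def, add_assoc]

theorem torusLabels_eq_append (n q t : ℕ) : torusLabels n q t =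
    ((List.range n).map fun j : ℕ => (j : ℤ) + height (n + 1) q (t + j)) ++
      [(n : ℤ) + height (n + 1) q (t + n)] := by
  simp [torusLabels, List.range_succ]

/-- The index at crossing number `k` is the height of `t` minus that of `t + k + 1`. It is nonzero
because `0 < k + 1 < n + 1` and heights separate residues modulo `n + 1`. -/
theorem colored_torus_pass {n q : ℕ} (hpq : q.Coprime (n + 1)) (t : ℕ) (r : List Label) :
    Colored (pass .pos (n + 1)) ((torusLabels n q t).map upward ++ r)
      ((torusLabels n q (t + 1)).map upward ++ r) n := by
  rw [torusLabels_eq_cons, torusLabels_eq_append]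
  have h := colored_pass_pos (height (n + 1) q t)
    ((List.range n).map fun j : ℕ => (j : ℤ) + 1 + height (n + 1) q (t + j + 1)) r ?_
  · convert h using 1
    · simp
    · have := height_add_period (n + 1) q t
      simp only [List.map_append, List.map_map, Function.comp_def, List.length_map,
        List.length_range]
      congr 3
      · funext j
        rw [add_right_comm t 1 j]
        congr 1; ring
      · rw [← this, add_comm, add_right_comm, add_assoc t n 1]
    · simp
  · intro k hk h
    simp only [List.length_map, List.length_range] at hk
    simp only [List.getElem_map, List.getElem_range] at h
    have h : height (n + 1) q t = height (n + 1) q (t + (k + 1)) := by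
      rw [← add_assoc]
      omega
    have h := (height_injective hpq h).symm
    rw [Nat.add_modEq_left_iff] at h
    exact Nat.not_dvd_of_pos_of_lt (by omega) (by omega) h

theorem colored_torus_passes {n q : ℕ} (hpq : q.Coprime (n + 1)) (t m : ℕ) (r : List Label) :
    Colored ((List.range m).flatMap fun _ => pass .pos (n + 1))
      ((torusLabels n q t).map upward ++ r)
      ((torusLabels n q (t + m)).map upward ++ r) (m * n) := by
  induction m with
  | zero => simp
  | succ m ih =>
    rw [List.range_succ, List.flatMap_append]
    convert ih.trans (n := n) ?_ using 1
    · push_cast; ring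
    · simpa [add_assoc] using colored_torus_pass hpq (t + m) r

theorem virtualTorusBraid_one (p q : ℕ) : virtualTorusBraid p (q + 1) 1 =
    pass .virt p ++ (List.range q).flatMap fun _ => pass .pos p := by
  simp [virtualTorusBraid, List.range_succ_eq_map, List.flatMap_cons, List.flatMap_map]

theorem mem_weights_VT {n m : ℕ} (hpq : (m + 1).Coprime (n + 1)) :
    (m * n : ℤ) ∈ (VT (n + 1) (m + 1) 1).weights := by
  change Colored (closure (n + 1) (virtualTorusBraid (n + 1) (m + 1) 1)) [] [] (m * n)
  rw [virtualTorusBraid_one]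
  refine colored_closure (l := (torusLabels n (m + 1) m).map upward) (by simp [torusLabels])
    fun r => ?_
  have h := colored_pass_virt (height (n + 1) (m + 1) m)
    ((List.range n).map fun j : ℕ => (j : ℤ) + 1 + height (n + 1) (m + 1) (m + j + 1)) r
  rw [← torusLabels_eq_cons, List.length_map, List.length_range] at h
  -- The labelling closes up through the virtual pass, which changes no label: a strand that moves
  -- one place to the left gains one in height, and the virtual strand goes from place 0 and height
  -- `n` to place `n` and height 0.
  have h' : ((List.range n).map fun j : ℕ => (j : ℤ) + 1 + height (n + 1) (m + 1) (m + j + 1)) ++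
      [(height (n + 1) (m + 1) m : ℤ)] = torusLabels n (m + 1) 0 := by
    rw [torusLabels_eq_append]
    congr 1
    · refine List.map_congr_left fun j hj => ?_
      rw [List.mem_range] at hj
      have := height_add hpq (j := j) (Nat.not_dvd_of_pos_of_lt (by omega) (by omega))
      rw [zero_add, this, add_right_comm m, add_comm (m + 1)]
      push_cast; ring
    · have h₀ := height_of_add_one_eq (n + 1) (m + 1) rfl
      have := height_add_height hpq (i := m) (j := n)
        (by rw [show m + n + 2 = (m + 1) + (n + 1) by ring]; simp [Nat.ModEq])
      rw [zero_add, h₀]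
      congr 1
      omega
  rw [h'] at h
  simpa using h.trans (colored_torus_passes hpq 0 m r)

/-! ### Moves on tangles -/

/-- Tangle diagrams with `n` strands at the bottom and `m` at the top are related by moves. -/
def Equivalent (n m : ℕ) : List Piece → List Piece → Prop :=
  Relation.EqvGen fun a b => Joins a n m ∧ Joins b n m ∧
    ∃ u v x y, LocalMove x y ∧ a = u ++ x ++ v ∧ b = u ++ y ++ v

namespace Equivalent

variable {n m k l : ℕ} {a b c u v : List Piece}

theorem refl (n m : ℕ) (a : List Piece) : Equivalent n m a a := Relation.EqvGen.refl a

theorem symm (h : Equivalent n m a b) : Equivalent n m b a := Relation.EqvGen.symm _ _ h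

theorem trans (h : Equivalent n m a b) (h' : Equivalent n m b c) : Equivalent n m a c :=
  Relation.EqvGen.trans _ _ _ h h'

theorem append (h : Equivalent n m a b) (hu : Joins u k n) (hv : Joins v m l) :
    Equivalent k l (u ++ a ++ v) (u ++ b ++ v) := by
  induction h with
  | rel a b h =>
    obtain ⟨ha, hb, u', v', x, y, hxy, rfl, rfl⟩ := h
    exact .rel _ _ ⟨joins_append (joins_append hu ha) hv, joins_append (joins_append hu hb) hv,
      u ++ u', v' ++ v, x, y, hxy, by simp, by simp⟩
  | refl a => exact refl _ _ _
  | symm a b _ ih => exact ih.symm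
  | trans a b c _ _ ih ih' => exact ih.trans ih'

theorem append_of_eq {a' b' : List Piece} (h : Equivalent n m a b) (u v : List Piece)
    (hu : Joins u k n) (hv : Joins v m l) (ha : a' = u ++ a ++ v) (hb : b' = u ++ b ++ v) :
    Equivalent k l a' b' := by
  subst ha hb
  exact h.append hu hv

theorem of_move (h : LocalMove a b) (ha : Joins a n m) (hb : Joins b n m) : Equivalent n m a b :=
  .rel _ _ ⟨ha, hb, [], [], a, b, h, by simp, by simp⟩

theorem toLink_eq {D E : Diagram} (h : Equivalent 0 0 D.word E.word) : D.toLink = E.toLink := by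
  -- `EqvGen` ranges over arbitrary words, so closedness is carried along in order to make the
  -- intermediate words diagrams.
  have key {a b : List Piece} (h : Equivalent 0 0 a b) : (Joins a 0 0 ↔ Joins b 0 0) ∧
      ∀ ha hb, Diagram.toLink ⟨a, ha⟩ = Diagram.toLink ⟨b, hb⟩ := by
    induction h with
    | rel a b h =>
      obtain ⟨ha, hb, u', v', x, y, hxy, h₁, h₂⟩ := h
      exact ⟨by simp [ha, hb], fun ha hb => Quot.sound ⟨u', v', x, y, hxy, h₁, h₂⟩⟩
    | refl a => exact ⟨Iff.rfl, fun _ _ => rfl⟩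
    | symm a b _ ih => exact ⟨ih.1.symm, fun ha hb => (ih.2 hb ha).symm⟩
    | trans a b c _ _ ih ih' =>
      exact ⟨ih.1.trans ih'.1, fun ha hc => (ih.2 ha (ih.1.1 ha)).trans (ih'.2 _ hc)⟩
  exact (key h).2 D.closed E.closed

end Equivalent

@[simp] theorem joins_nil {n m : ℕ} : Joins [] n m ↔ n = m := Iff.rfl

@[simp] theorem joins_cup_cons {i n m : ℕ} {w : List Piece} :
    Joins (cup i :: w) n m ↔ i ≤ n ∧ Joins w (n + 2) m := by
  constructor
  · rintro ⟨l, ⟨r, h₁, h₂⟩, h⟩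
    simp only [cup, Kind.bottom, Kind.top] at h₁ h₂
    exact ⟨by omega, by rwa [show n + 2 = l by omega]⟩
  · rintro ⟨h, h'⟩
    exact ⟨_, ⟨n - i, by simp only [cup, Kind.bottom, Kind.top]; omega⟩, h'⟩

@[simp] theorem joins_cap_cons {i n m : ℕ} {w : List Piece} :
    Joins (cap i :: w) n m ↔ i + 2 ≤ n ∧ Joins w (n - 2) m := by
  constructor
  · rintro ⟨l, ⟨r, h₁, h₂⟩, h⟩
    simp only [cap, Kind.bottom, Kind.top] at h₁ h₂
    exact ⟨by omega, by rwa [show n - 2 = l by omega]⟩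
  · rintro ⟨h, h'⟩
    exact ⟨_, ⟨n - 2 - i, by simp only [cap, Kind.bottom, Kind.top]; omega⟩, h'⟩

@[simp] theorem joins_cross_cons {c : Crossing} {i n m : ℕ} {w : List Piece} :
    Joins (cross c i :: w) n m ↔ i + 2 ≤ n ∧ Joins w n m := by
  constructor
  · rintro ⟨l, ⟨r, h₁, h₂⟩, h⟩
    simp only [cross, Kind.bottom, Kind.top] at h₁ h₂
    exact ⟨by omega, by rwa [show n = l by omega]⟩
  · rintro ⟨h, h'⟩
    exact ⟨_, ⟨n - 2 - i, by simp only [cross, Kind.bottom, Kind.top]; omega⟩, h'⟩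

/-! ### Braids, overstrands and virtual strands -/

/-- A braid diagram on the first `p` strands. -/
def IsBraid (p : ℕ) (w : List Piece) : Prop := ∀ x ∈ w, ∃ c i, x = cross c i ∧ i + 1 < p

namespace IsBraid

variable {p N : ℕ} {u v w : List Piece}

theorem nil (p : ℕ) : IsBraid p [] := by simp [IsBraid]

theorem cons {c : Crossing} {i : ℕ} (hi : i + 1 < p) (hw : IsBraid p w) :
    IsBraid p (cross c i :: w) := by
  rintro x (_ | ⟨_, hx⟩)
  · exact ⟨c, i, rfl, hi⟩
  · exact hw x hx

theorem append (hu : IsBraid p u) (hv : IsBraid p v) : IsBraid p (u ++ v) := fun x hx =>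
  (List.mem_append.1 hx).elim (hu x) (hv x)

theorem left (h : IsBraid p (u ++ v)) : IsBraid p u := fun x hx =>
  h x (List.mem_append.2 (.inl hx))

theorem right (h : IsBraid p (u ++ v)) : IsBraid p v := fun x hx =>
  h x (List.mem_append.2 (.inr hx))

theorem mono {p' : ℕ} (h : IsBraid p w) (hp : p ≤ p') : IsBraid p' w := fun x hx =>
  let ⟨c, i, h, hi⟩ := h x hx
  ⟨c, i, h, hi.trans_le hp⟩

theorem joins (hw : IsBraid p w) (hp : p ≤ N) : Joins w N N := by
  induction w with
  | nil => rfl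
  | cons x w ih =>
    obtain ⟨c, i, rfl, hi⟩ := hw x (by simp)
    exact joins_cross_cons.2 ⟨by omega, ih fun y hy => hw y (by simp [hy])⟩

end IsBraid

theorem isBraid_pass (c : Crossing) (p : ℕ) : IsBraid p (pass c p) := by
  intro x hx
  simp only [pass, List.mem_map, List.mem_range] at hx
  obtain ⟨i, hi, rfl⟩ := hx
  exact ⟨c, i, rfl, by omega⟩

theorem pass_succ_succ (c : Crossing) (p : ℕ) : pass c (p + 2) = pass c (p + 1) ++ [cross c p] := by
  simp [pass, List.range_succ]

variable {N : ℕ}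

theorem cross_comm_of_lt (c d : Crossing) {i j : ℕ} (hi : i + 1 < j) (hj : j + 1 < N) :
    Equivalent N N [cross c i, cross d j] [cross d j, cross c i] := by
  obtain ⟨k, rfl⟩ := Nat.exists_eq_add_of_lt hi
  refine .of_move ?_ (by simp; omega) (by simp; omega)
  convert LocalMove.exchange (.cross c) (.cross d) i k using 3 <;>
    simp [cross, Kind.top, Kind.bottom] <;> omega

theorem cross_comm (c d : Crossing) {i j : ℕ} (h : i + 1 < j ∨ j + 1 < i) (hi : i + 1 < N)
    (hj : j + 1 < N) : Equivalent N N [cross c i, cross d j] [cross d j, cross c i] :=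
  h.elim (fun h => cross_comm_of_lt c d h hj) fun h => (cross_comm_of_lt d c h hi).symm

theorem cross_comm_word {c : Crossing} {i : ℕ} (hi : i + 1 < N) {w : List Piece}
    (hw : ∀ x ∈ w, ∃ d j, x = cross d j ∧ (i + 1 < j ∨ j + 1 < i) ∧ j + 1 < N) :
    Equivalent N N (cross c i :: w) (w ++ [cross c i]) := by
  induction w with
  | nil => exact .refl _ _ _
  | cons x w ih =>
    obtain ⟨d, j, rfl, h, hj⟩ := hw x (by simp)
    have hw' : IsBraid N w := fun x hx =>
      let ⟨d, j, h, _, hj⟩ := hw x (by simp [hx])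
      ⟨d, j, h, hj⟩
    exact ((cross_comm c d h hi hj).append_of_eq [] w rfl (hw'.joins le_rfl) rfl rfl).trans
      ((ih fun x hx => hw x (by simp [hx])).append_of_eq [cross d j] [] (by simp; omega) rfl
        (by simp) (by simp))

/-- The strand number `a + k` runs to the left, above `k` strands, to the place `a`. -/
def overstrand (a : ℕ) : ℕ → List Piece
  | 0 => []
  | k + 1 => cross .neg (a + k) :: overstrand a k

theorem overstrand_succ (a k : ℕ) :
    overstrand a (k + 1) = overstrand (a + 1) k ++ [cross .neg a] := by
  induction k with
  | zero => simp [overstrand]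
  | succ k ih =>
    rw [overstrand, ih, overstrand, List.cons_append, add_assoc a 1 k, add_comm 1 k]

theorem overstrand_add (a k l : ℕ) :
    overstrand a (k + l) = overstrand (a + l) k ++ overstrand a l := by
  induction k with
  | zero => simp [overstrand]
  | succ k ih =>
    rw [Nat.add_right_comm k 1 l, overstrand, ih, overstrand, List.cons_append, add_assoc a l k,
      add_comm l k]

theorem mem_overstrand {a k : ℕ} {x : Piece} (hx : x ∈ overstrand a k) :
    ∃ j, x = cross .neg j ∧ a ≤ j ∧ j < a + k := by
  induction k with
  | zero => simp [overstrand] at hx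
  | succ k ih =>
    rcases hx with _ | ⟨_, hx⟩
    · exact ⟨a + k, rfl, by omega⟩
    · obtain ⟨j, rfl, h₁, h₂⟩ := ih hx
      exact ⟨j, rfl, by omega⟩

theorem isBraid_overstrand (a k : ℕ) : IsBraid (a + k + 1) (overstrand a k) := fun _ hx =>
  let ⟨j, hx, _, hj⟩ := mem_overstrand hx
  ⟨_, j, hx, by omega⟩

theorem overstrand_far {a k i : ℕ} (h : i + 1 < a ∨ a + k < i) (hN : a + k < N) :
    ∀ x ∈ overstrand a k, ∃ d j, x = cross d j ∧ (i + 1 < j ∨ j + 1 < i) ∧ j + 1 < N := fun _ hx =>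
  let ⟨j, hx, _, _⟩ := mem_overstrand hx
  ⟨_, j, hx, by omega, by omega⟩

theorem overstrand_cross_of_lt {c : Crossing} {a k i : ℕ} (hi : i + 1 < a) (hN : a + k < N) :
    Equivalent N N (overstrand a k ++ [cross c i]) (cross c i :: overstrand a k) :=
  (cross_comm_word (by omega) (overstrand_far (.inl hi) hN)).symm

/-- A crossing is moved below the overstrand. -/
theorem overstrand_cross_of_gt {c : Crossing} (hc : c ≠ .virt) {a k i : ℕ} (hi : a ≤ i)
    (hk : i + 1 < a + k) (hN : a + k < N) :
    Equivalent N N (overstrand a k ++ [cross c (i + 1)]) (cross c i :: overstrand a k) := by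
  obtain ⟨j, rfl⟩ := Nat.exists_eq_add_of_le hi
  obtain ⟨l, rfl⟩ : ∃ l, k = l + (j + 1 + 1) := ⟨k - (j + 2), by omega⟩
  have h₁ : Equivalent N N (overstrand a j ++ [cross c (a + j + 1)])
      (cross c (a + j + 1) :: overstrand a j) :=
    (cross_comm_word (by omega) (overstrand_far (.inr (by omega)) (by omega))).symm
  have h₂ : Equivalent N N [cross .neg (a + j + 1), cross .neg (a + j), cross c (a + j + 1)]
      [cross c (a + j), cross .neg (a + j + 1), cross .neg (a + j)] :=
    (Equivalent.of_move (LocalMove.r3 c .neg .neg (a + j) hc (by simp) (by simp)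
      (by rintro ⟨rfl, h⟩; simp [Crossing.flip] at h)) (by simp; omega) (by simp; omega)).symm
  have h₃ : Equivalent N N (overstrand (a + (j + 1 + 1)) l ++ [cross c (a + j)])
      (cross c (a + j) :: overstrand (a + (j + 1 + 1)) l) :=
    overstrand_cross_of_lt (by omega) (by omega)
  have hj : Joins (overstrand (a + (j + 1 + 1)) l) N N := (isBraid_overstrand _ _).joins (by omega)
  have hj' : Joins (overstrand a j) N N := (isBraid_overstrand _ _).joins (by omega)
  rw [overstrand_add]
  simp only [overstrand]
  refine (h₁.append_of_eq (overstrand (a + (j + 1 + 1)) l ++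
    [cross .neg (a + j + 1), cross .neg (a + j)]) [] (joins_append hj (by simp; omega)) rfl
    (by simp; rfl) rfl).trans ?_
  refine (h₂.append_of_eq (overstrand (a + (j + 1 + 1)) l) (overstrand a j) hj hj' (by simp)
    rfl).trans ?_
  exact h₃.append_of_eq [] ([cross .neg (a + j + 1), cross .neg (a + j)] ++ overstrand a j) rfl
    (joins_append (l := N) (by simp; omega) hj') (by simp) (by simp; rfl)

/-- A crossing is moved along the strands below a virtual strand. -/
theorem cross_pass_virt {c : Crossing} (hc : c ≠ .virt) {p i : ℕ} (hi : i + 2 < p) (hN : p ≤ N) :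
    Equivalent N N (cross c (i + 1) :: pass .virt p) (pass .virt p ++ [cross c i]) := by
  obtain ⟨k, rfl⟩ : ∃ k, p = i + 2 + k + 1 := ⟨p - (i + 3), by omega⟩
  have hp : pass .virt (i + 2 + k + 1) = (List.range i).map (cross .virt) ++
      [cross .virt i, cross .virt (i + 1)] ++
      (List.range k).map (fun j => cross .virt (i + 2 + j)) := by
    simp [pass, List.range_add, List.range_succ]
  have hu : ∀ x ∈ (List.range i).map (cross .virt), ∃ d j, x = cross d j ∧
      (i + 1 + 1 < j ∨ j + 1 < i + 1) ∧ j + 1 < N := by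
    intro x hx
    simp only [List.mem_map, List.mem_range] at hx
    obtain ⟨j, hj, rfl⟩ := hx
    exact ⟨_, j, rfl, by omega, by omega⟩
  have hv : ∀ x ∈ (List.range k).map (fun j => cross .virt (i + 2 + j)), ∃ d j, x = cross d j ∧
      (i + 1 < j ∨ j + 1 < i) ∧ j + 1 < N := by
    intro x hx
    simp only [List.mem_map, List.mem_range] at hx
    obtain ⟨j, hj, rfl⟩ := hx
    exact ⟨_, _, rfl, by omega, by omega⟩
  have hb := (isBraid_pass .virt (i + 2 + k + 1)).mono hN
  rw [hp] at hb ⊢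
  have h₂ : Equivalent N N [cross c (i + 1), cross .virt i, cross .virt (i + 1)]
      [cross .virt i, cross .virt (i + 1), cross c i] :=
    (Equivalent.of_move (LocalMove.mr_third c i hc) (by simp; omega) (by simp; omega)).symm
  refine ((cross_comm_word (c := c) (i := i + 1) (by omega) hu).append_of_eq []
    ([cross .virt i, cross .virt (i + 1)] ++
      (List.range k).map (fun j => cross .virt (i + 2 + j))) rfl
      (joins_append (hb.left.right.joins le_rfl) (hb.right.joins le_rfl)) (by simp) rfl).trans ?_
  refine (h₂.append_of_eq ((List.range i).map (cross .virt))
    ((List.range k).map (fun j => cross .virt (i + 2 + j))) (hb.left.left.joins le_rfl)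
    (hb.right.joins le_rfl) (by simp) rfl).trans ?_
  exact (cross_comm_word (c := c) (by omega) hv).append_of_eq
    ((List.range i).map (cross .virt) ++ [cross .virt i, cross .virt (i + 1)]) []
    (hb.left.joins le_rfl) rfl (by simp) (by simp)

/-- Each crossing is carried past the virtual strand by MR. It moves one place to the left because
the virtual strand changes from its left side to its right side. -/
theorem overstrand_pass_virt {p a k : ℕ} (hp : a + k + 1 < p) (hN : p ≤ N) :
    Equivalent N N (overstrand (a + 1) k ++ pass .virt p) (pass .virt p ++ overstrand a k) := by
  induction k with
  | zero => simpa [overstrand] using Equivalent.refl _ _ _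
  | succ k ih =>
    have h := ih (by omega)
    have h' := cross_pass_virt (c := .neg) (by simp) (p := p) (i := a + k) (by omega) hN
    simp only [overstrand]
    refine (h.append_of_eq [cross .neg (a + 1 + k)] [] (by simp; omega) rfl (by simp)
      (by simp; rfl)).trans ?_
    rw [add_right_comm a 1 k]
    exact h'.append_of_eq [] (overstrand a k) rfl ((isBraid_overstrand _ _).joins (by omega))
      (by simp) (by simp)

/-! ### Closed braids: conjugation and destabilization -/

/-- The crossing is slid through both nested minima. Each slide flips it, so it arrives on the
returning strands with its original type. -/
theorem cup_cup_cross (c : Crossing) {i n : ℕ} (hi : i ≤ n) :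
    Equivalent n (n + 4) [cup i, cup (i + 1), cross c i] [cup i, cup (i + 1), cross c (i + 2)] := by
  have h₁ : Equivalent (n + 2) (n + 4) [cup (i + 1), cross c i] [cup i, cross c.flip (i + 1)] :=
    .of_move (.slide_cup c i) (by simp; omega) (by simp; omega)
  have h₂ : Equivalent n (n + 4) [cup i, cup (i + 2)] [cup i, cup i] :=
    .of_move (.exchange .cup .cup i 0) (by simp; omega) (by simp; omega)
  have h₃ : Equivalent (n + 2) (n + 4) [cup (i + 2), cross c.flip (i + 1)]
      [cup (i + 1), cross c.flip.flip (i + 2)] :=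
    .of_move (.slide_cup c.flip (i + 1)) (by simp; omega) (by simp; omega)
  have h₄ : c.flip.flip = c := by cases c <;> rfl
  rw [h₄] at h₃
  exact ((h₁.append_of_eq [cup i] [] (by simp; omega) rfl rfl rfl).trans
    (h₂.symm.append_of_eq [] [cross c.flip (i + 1)] rfl (by simp; omega) rfl rfl)).trans
    (h₃.append_of_eq [cup i] [] (by simp; omega) rfl rfl rfl)

theorem cross_cap_cap (c : Crossing) {i n : ℕ} (hi : i ≤ n) :
    Equivalent (n + 4) n [cross c i, cap (i + 1), cap i] [cross c (i + 2), cap (i + 1), cap i] := by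
  have h₁ : Equivalent (n + 4) (n + 2) [cross c i, cap (i + 1)] [cross c.flip (i + 1), cap i] :=
    .of_move (.slide_cap c i) (by simp; omega) (by simp; omega)
  have h₂ : Equivalent (n + 4) n [cap i, cap i] [cap (i + 2), cap i] :=
    .of_move (.exchange .cap .cap i 0) (by simp; omega) (by simp; omega)
  have h₃ : Equivalent (n + 4) (n + 2) [cross c.flip (i + 1), cap (i + 2)]
      [cross c.flip.flip (i + 2), cap (i + 1)] :=
    .of_move (.slide_cap c.flip (i + 1)) (by simp; omega) (by simp; omega)
  have h₄ : c.flip.flip = c := by cases c <;> rfl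
  rw [h₄] at h₃
  exact ((h₁.append_of_eq [] [cap i] rfl (by simp; omega) rfl rfl).trans
    (h₂.append_of_eq [cross c.flip (i + 1)] [] (by simp; omega) (by simp) rfl rfl)).trans
    (h₃.append_of_eq [] [cap i] rfl (by simp; omega) rfl rfl)

theorem cross_cup_comm (c : Crossing) {i j n : ℕ} (hi : i + 1 < j) (hj : j ≤ n) :
    Equivalent n (n + 2) [cross c i, cup j] [cup j, cross c i] := by
  obtain ⟨k, rfl⟩ := Nat.exists_eq_add_of_lt hi
  refine .of_move ?_ (by simp; omega) (by simp; omega)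
  convert LocalMove.exchange (.cross c) .cup i k using 3 <;>
    simp [cross, cup, Kind.top, Kind.bottom] <;> omega

theorem cup_cross_comm (c : Crossing) {i j n : ℕ} (hi : i ≤ j) (hj : j + 1 < n) :
    Equivalent n (n + 2) [cup i, cross c (j + 2)] [cross c j, cup i] := by
  obtain ⟨k, rfl⟩ := Nat.exists_eq_add_of_le hi
  refine .of_move ?_ (by simp; omega) (by simp; omega)
  rw [add_right_comm]
  exact LocalMove.exchange .cup (.cross c) i k

theorem cross_cap_comm (c : Crossing) {i j n : ℕ} (hi : i + 1 < j) (hj : j ≤ n) :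
    Equivalent (n + 2) n [cross c i, cap j] [cap j, cross c i] := by
  obtain ⟨k, rfl⟩ := Nat.exists_eq_add_of_lt hi
  refine .of_move ?_ (by simp; omega) (by simp; omega)
  convert LocalMove.exchange (.cross c) .cap i k using 3 <;>
    simp [cross, cap, Kind.top, Kind.bottom] <;> omega

theorem cap_cross_comm (c : Crossing) {i j n : ℕ} (hi : i ≤ j) (hj : j + 1 < n) :
    Equivalent (n + 2) n [cap i, cross c j] [cross c (j + 2), cap i] := by
  obtain ⟨k, rfl⟩ := Nat.exists_eq_add_of_le hi
  refine .of_move ?_ (by simp; omega) (by simp; omega)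
  rw [add_right_comm]
  exact LocalMove.exchange .cap (.cross c) i k

/-- A crossing is moved through the minima of a closed braid. -/
theorem cups_cross (c : Crossing) {i j p : ℕ} (hi : i + 1 < p) (hj : i + j + 2 = 2 * p) :
    Equivalent 0 (2 * p) ((List.range p).map cup ++ [cross c i])
      ((List.range p).map cup ++ [cross c j]) := by
  induction p generalizing j with
  | zero => omega
  | succ p ih =>
    rw [List.range_succ, List.map_append, List.map_singleton]
    obtain rfl | hp := eq_or_lt_of_le (Nat.le_of_lt_succ hi)
    · obtain rfl : j = i + 2 := by omega
      refine (cup_cup_cross c (i := i) (n := 2 * i) (by omega)).append_of_eq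
        ((List.range i).map cup) [] (joins_cups i) (by simp; omega) ?_ ?_ <;>
        simp [List.range_succ]
    · obtain ⟨j, rfl⟩ : ∃ k, j = k + 2 := ⟨j - 2, by omega⟩
      refine ((cross_cup_comm c (n := 2 * p) hp (by omega)).symm.append_of_eq
        ((List.range p).map cup) [] (joins_cups p) rfl (by simp) rfl).trans ?_
      refine ((ih hp (j := j) (by omega)).append_of_eq [] [cup p] rfl (by simp; omega) (by simp)
        rfl).trans ?_
      exact (cup_cross_comm c (i := p) (j := j) (n := 2 * p) (by omega)
        (by omega)).symm.append_of_eq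
        ((List.range p).map cup) [] (joins_cups p) rfl (by simp) (by simp)

/-- A crossing is moved through the maxima of a closed braid. -/
theorem cross_caps (c : Crossing) {i j p : ℕ} (hi : i + 1 < p) (hj : i + j + 2 = 2 * p) :
    Equivalent (2 * p) 0 (cross c i :: (List.range p).reverse.map cap)
      (cross c j :: (List.range p).reverse.map cap) := by
  induction p generalizing j with
  | zero => omega
  | succ p ih =>
    simp only [List.range_succ, List.reverse_append, List.reverse_singleton,
      List.singleton_append]
    obtain rfl | hp := eq_or_lt_of_le (Nat.le_of_lt_succ hi)
    · obtain rfl : j = i + 2 := by omega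
      refine (cross_cap_cap c (i := i) (n := 2 * i) (by omega)).append_of_eq
        [] ((List.range i).reverse.map cap) (by simp; omega) (joins_caps i) ?_ ?_ <;>
        simp [List.range_succ]
    · obtain ⟨j, rfl⟩ : ∃ k, j = k + 2 := ⟨j - 2, by omega⟩
      refine ((cross_cap_comm c (n := 2 * p) hp (by omega)).append_of_eq
        [] ((List.range p).reverse.map cap) rfl (joins_caps p) rfl rfl).trans ?_
      refine ((ih hp (j := j) (by omega)).append_of_eq [cap p] [] (by simp; omega) rfl (by simp)
        rfl).trans ?_
      exact (cap_cross_comm c (i := p) (j := j) (n := 2 * p) (by omega) (by omega)).append_of_eq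
        [] ((List.range p).reverse.map cap) rfl (joins_caps p) (by simp) rfl

theorem Equivalent.closure {p : ℕ} {u v : List Piece} (h : Equivalent (2 * p) (2 * p) u v) :
    Equivalent 0 0 (closure p u) (closure p v) :=
  h.append (joins_cups p) (joins_caps p)

/-- The crossing goes through the minima to the mirror place `j = 2 * p - 2 - i` on the returning
strands, rises there to the right of `w`, and comes back through the maxima. -/
theorem closure_cross_cons (c : Crossing) {i p : ℕ} {w : List Piece} (hi : i + 1 < p)
    (hw : IsBraid p w) :
    Equivalent 0 0 (closure p (cross c i :: w)) (closure p (w ++ [cross c i])) := by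
  obtain ⟨j, hj⟩ : ∃ j, i + j + 2 = 2 * p := ⟨2 * p - 2 - i, by omega⟩
  have hJ := hw.joins (N := 2 * p) (by omega)
  have hfar : ∀ x ∈ w, ∃ d k, x = cross d k ∧ (j + 1 < k ∨ k + 1 < j) ∧ k + 1 < 2 * p := by
    intro x hx
    obtain ⟨d, k, rfl, hk⟩ := hw x hx
    exact ⟨d, k, rfl, by omega, by omega⟩
  refine ((cups_cross c hi hj).append_of_eq [] (w ++ (List.range p).reverse.map cap) rfl
    (joins_append hJ (joins_caps p)) (by simp [closure]) rfl).trans ?_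
  refine ((cross_comm_word (c := c) (i := j) (by omega) hfar).append_of_eq ((List.range p).map cup)
    ((List.range p).reverse.map cap) (joins_cups p) (joins_caps p) (by simp) rfl).trans ?_
  exact (cross_caps c hi hj).symm.append_of_eq ((List.range p).map cup ++ w) []
    (joins_append (joins_cups p) hJ) rfl (by simp) (by simp [closure])

theorem closure_append_comm {p : ℕ} {u v : List Piece} (hu : IsBraid p u) (hv : IsBraid p v) :
    Equivalent 0 0 (closure p (u ++ v)) (closure p (v ++ u)) := by
  induction u generalizing v with
  | nil => simpa using Equivalent.refl _ _ _
  | cons x u ih =>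
    obtain ⟨c, i, rfl, hi⟩ := hu x (by simp)
    have hu' : IsBraid p u := fun y hy => hu y (by simp [hy])
    refine (closure_cross_cons c hi (hu'.append hv)).trans ?_
    simpa using ih hu' (hv.append (.cons hi (.nil p)))

theorem braid_cup_comm {p n : ℕ} {w : List Piece} (hw : IsBraid p w) (hp : p ≤ n) :
    Equivalent n (n + 2) (w ++ [cup p]) (cup p :: w) := by
  induction w with
  | nil => exact .refl _ _ _
  | cons x w ih =>
    obtain ⟨c, i, rfl, hi⟩ := hw x (by simp)
    have hw' : IsBraid p w := fun y hy => hw y (by simp [hy])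
    exact ((ih hw').append_of_eq [cross c i] [] (by simp; omega) rfl (by simp) (by simp)).trans
      ((cross_cup_comm c hi hp).append_of_eq [] w rfl (hw'.joins (by omega)) rfl rfl)

theorem braid_cap_comm {p n : ℕ} {w : List Piece} (hw : IsBraid p w) (hp : p ≤ n) :
    Equivalent (n + 2) n (w ++ [cap p]) (cap p :: w) := by
  induction w with
  | nil => exact .refl _ _ _
  | cons x w ih =>
    obtain ⟨c, i, rfl, hi⟩ := hw x (by simp)
    have hw' : IsBraid p w := fun y hy => hw y (by simp [hy])
    exact ((ih hw').append_of_eq [cross c i] [] (by simp; omega) rfl (by simp) (by simp)).trans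
      ((cross_cap_comm c hi hp).append_of_eq [] w rfl (hw'.joins (by omega)) rfl rfl)

/-- Markov destabilization. -/
theorem closure_destabilize (c : Crossing) {p : ℕ} (hp : 0 < p) {u v : List Piece}
    (hu : IsBraid p u) (hv : IsBraid p v) :
    Equivalent 0 0 (closure (p + 1) (u ++ [cross c (p - 1)] ++ v)) (closure p (u ++ v)) := by
  obtain ⟨p, rfl⟩ := Nat.exists_eq_add_of_lt hp
  rw [zero_add] at *
  -- Once the innermost minimum and maximum are brought next to the only crossing on the last
  -- strand, that strand is a kink. It is removed by a slide, R1 or VR1, and straightening.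
  have h : Equivalent (2 * (p + 1)) (2 * (p + 1))
      [cup (p + 1), cross c p, cap (p + 1)] [] := by
    have h₁ : Equivalent (2 * (p + 1)) (2 * (p + 1) + 2) [cup (p + 1), cross c p]
        [cup p, cross c.flip (p + 1)] :=
      .of_move (.slide_cup c p) (by simp; omega) (by simp; omega)
    have h₂ : Equivalent (2 * (p + 1) + 2) (2 * (p + 1)) [cross c.flip (p + 1), cap (p + 1)]
        [cap (p + 1)] := .of_move (.r1_cap c.flip (p + 1)) (by simp) (by simp)
    have h₃ : Equivalent (2 * (p + 1)) (2 * (p + 1)) [cup p, cap (p + 1)] [] :=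
      .of_move (.zigzag_right p) (by simp; omega) rfl
    exact ((h₁.append_of_eq [] [cap (p + 1)] rfl (by simp) rfl rfl).trans
      (h₂.append_of_eq [cup p] [] (by simp; omega) rfl rfl rfl)).trans h₃
  have hu' := hu.joins (N := 2 * (p + 1)) (by omega)
  have hv' := hv.joins (N := 2 * (p + 1)) (by omega)
  have hv'' := hv.joins (N := 2 * (p + 1) + 2) (by omega)
  refine ((braid_cup_comm (n := 2 * (p + 1)) hu (by omega)).symm.append_of_eq
    ((List.range (p + 1)).map cup)
    ([cross c p] ++ v ++ cap (p + 1) :: (List.range (p + 1)).reverse.map cap) (joins_cups _)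
    (joins_append (joins_append (l := 2 * (p + 1) + 2) (by simp; omega) hv'')
      (joins_cap_cons.2 ⟨by omega, joins_caps _⟩))
    (by simp [closure, List.range_succ]) rfl).trans ?_
  refine ((braid_cap_comm (n := 2 * (p + 1)) hv (by omega)).append_of_eq
    ((List.range (p + 1)).map cup ++ u ++ [cup (p + 1), cross c p])
    ((List.range (p + 1)).reverse.map cap)
    (joins_append (joins_append (joins_cups _) hu') (by simp; omega))
    (joins_caps _) (by simp) rfl).trans ?_
  exact h.append_of_eq ((List.range (p + 1)).map cup ++ u)
    (v ++ (List.range (p + 1)).reverse.map cap) (joins_append (joins_cups _) hu')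
    (joins_append hv' (joins_caps _)) (by simp) (by simp [closure])

/-! ### Layered braids and their closures -/

/-- The overstrand of the crossing is the one with the smaller value, for values `x` and `y` of
the strands that come from the left and from the right. -/
def Crossing.Fits : Crossing → ℕ → ℕ → Prop
  | pos, x, y => x < y
  | neg, x, y => y < x
  | virt, _, _ => False

theorem Crossing.Fits.ne_virt {c : Crossing} {x y : ℕ} (h : c.Fits x y) : c ≠ .virt := by
  rintro rfl
  exact h

theorem Crossing.Fits.eq_pos {c : Crossing} {x y : ℕ} (h : c.Fits x y) (hxy : x < y) :
    c = .pos := by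
  cases c
  · rfl
  · exact absurd hxy (Nat.lt_asymm h)
  · exact h.elim

theorem Crossing.Fits.eq_neg {c : Crossing} {x y : ℕ} (h : c.Fits x y) (hxy : y < x) :
    c = .neg := by
  cases c
  · exact absurd hxy (Nat.lt_asymm h)
  · rfl
  · exact h.elim

theorem Crossing.Fits.map {c : Crossing} {x y : ℕ} (h : c.Fits x y) {f : ℕ → ℕ}
    (hxy : x < y → f x < f y) (hyx : y < x → f y < f x) : c.Fits (f x) (f y) := by
  cases c
  · exact hxy h
  · exact hyx h
  · exact h

/-- A braid whose strands lie in layers: `s` and `t` are the depths of the strands at the bottom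
and at the top, and a strand of smaller depth lies above every strand of greater depth. -/
inductive Layered : List Piece → List ℕ → List ℕ → Prop
  | nil (s : List ℕ) : Layered [] s s
  | cons {c : Crossing} {w : List Piece} {l r t : List ℕ} {x y : ℕ} (h : c.Fits x y)
      (hw : Layered w (l ++ y :: x :: r) t) :
      Layered (cross c l.length :: w) (l ++ x :: y :: r) t

namespace Layered

variable {u v w : List Piece} {s t r : List ℕ}

theorem trans (hu : Layered u s t) (hv : Layered v t r) : Layered (u ++ v) s r := by
  induction hu with
  | nil => exact hv
  | cons h _ ih => exact .cons h (ih hv)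

theorem perm (h : Layered w s t) : s.Perm t := by
  induction h with
  | nil => rfl
  | cons _ _ ih => exact ((List.Perm.swap _ _ _).append_left _).trans ih

theorem isBraid (h : Layered w s t) : IsBraid s.length w := by
  induction h with
  | nil => exact .nil _
  | cons _ _ ih => exact .cons (by simp) (by simpa using ih)

theorem map (h : Layered w s t) {f : ℕ → ℕ} (hf : ∀ x ∈ s, ∀ y ∈ s, x < y → f x < f y) :
    Layered w (s.map f) (t.map f) := by
  induction h with
  | nil => exact .nil _
  | @cons c w l r t x y h _ ih =>
    have ih := ih fun a ha b hb => hf a (by simp at ha ⊢; tauto) b (by simp at hb ⊢; tauto)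
    simp only [List.map_append, List.map_cons] at ih ⊢
    have := Layered.cons (h.map (hf x (by simp) y (by simp)) (hf y (by simp) x (by simp))) ih
    rwa [List.length_map] at this

theorem overstrand (l r s : List ℕ) {z : ℕ} (hz : ∀ y ∈ r, z < y) :
    Layered (overstrand l.length r.length) (l ++ r ++ z :: s) (l ++ z :: r ++ s) := by
  induction r using List.reverseRecOn generalizing s with
  | nil => simpa [VirtualKnot.overstrand] using Layered.nil _
  | append_singleton r y ih =>
    have ih := ih (y :: s) fun x hx => hz x (by simp [hx])
    have := Layered.cons (c := .neg) (l := l ++ r) (x := y) (y := z) (r := s) (hz y (by simp))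
      (by simpa using ih)
    simpa [VirtualKnot.overstrand] using this

/-- The strand on the top layer can be pulled off. -/
theorem exists_overstrand (h : Layered w s t) {N : ℕ} (hN : s.length ≤ N) {l r : List ℕ} {z : ℕ}
    (hs : s = l ++ z :: r) (hz : ∀ y ∈ l ++ r, z < y) :
    ∃ w' l' r', t = l' ++ z :: r' ∧ Layered w' (l ++ r) (l' ++ r') ∧
      Equivalent N N (VirtualKnot.overstrand l.length r.length ++ w)
        (w' ++ VirtualKnot.overstrand l'.length r'.length) := by
  induction h generalizing l r with
  | nil => exact ⟨[], l, r, hs, .nil _, by simpa using Equivalent.refl _ _ _⟩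
  | @cons c w l₀ r₀ t x y h hw ih =>
    have hJ : Joins w N N := hw.isBraid.joins (by simpa using hN)
    have ih' := fun {l r} => ih (by simpa using hN) (l := l) (r := r)
    -- The strand `z` is kept at the far right, and the overstrand records its true place. If `z`
    -- enters the crossing from the left, R2 cancels it with the last crossing of the overstrand
    -- (this case appears in both branches); if from the right, the crossing joins the overstrand. A
    -- crossing to the left of `z` commutes, and one to its right passes below by R3.
    obtain ⟨a, rfl, ha⟩ | ⟨a, rfl, ha⟩ := List.append_eq_append_iff.1 hs
    · rcases a with _ | ⟨x', _ | ⟨y', a⟩⟩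
      · obtain ⟨rfl, rfl⟩ := List.cons.inj ha
        simp only [List.append_nil] at hz ⊢
        obtain rfl := h.eq_pos (hz y (by simp))
        obtain ⟨w', l', r', rfl, hw', hE⟩ := ih' (l := l₀ ++ [y]) (r := r₀) (by simp)
          (by simpa using hz)
        refine ⟨w', l', r', rfl, by simpa using hw', .trans ?_ hE⟩
        have h₂ : Equivalent N N [cross .neg l₀.length, cross .pos l₀.length] [] :=
          .of_move (.r2 .neg _) (by simp at hN ⊢; omega) rfl
        refine h₂.append_of_eq (VirtualKnot.overstrand (l₀.length + 1) r₀.length) w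
          ((isBraid_overstrand _ _).joins ?_) hJ ?_ ?_
        · simp at hN; omega
        · simp [overstrand_succ]
        · simp
      · simp only [List.cons_append, List.nil_append, List.cons.injEq] at ha
        obtain ⟨rfl, rfl, rfl⟩ := ha
        obtain rfl := h.eq_neg (hz x (by simp))
        obtain ⟨w', l', r', rfl, hw', hE⟩ := ih' (l := l₀) (r := x :: r₀) (by simp)
          (by simpa using hz)
        refine ⟨w', l', r', rfl, by simpa using hw', ?_⟩
        simpa [overstrand_succ] using hE
      · simp only [List.cons_append, List.cons.injEq] at ha
        obtain ⟨rfl, rfl, rfl⟩ := ha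
        obtain ⟨w', l', r', rfl, hw', hE⟩ := ih' (l := l₀ ++ y :: x :: a) (r := r) (by simp)
          (fun b hb => hz b (by simp at hb ⊢; tauto))
        refine ⟨cross c l₀.length :: w', l', r', rfl, ?_, ?_⟩
        · simpa using Layered.cons h (by simpa using hw')
        · simp only [List.length_append, List.length_cons] at hN hE ⊢
          refine ((overstrand_cross_of_lt (c := c) (i := l₀.length)
            (a := l₀.length + (a.length + 1 + 1)) (k := r.length) (by omega)
            (by omega)).append_of_eq [] w rfl hJ (by simp) rfl).trans ?_
          exact hE.append_of_eq [cross c l₀.length] [] (by simp; omega) rfl (by simp) (by simp)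
    · rcases a with _ | ⟨z', a⟩
      · obtain ⟨rfl, rfl⟩ := List.cons.inj ha
        simp only [List.append_nil] at ih' hw hN hs ⊢
        obtain rfl := h.eq_pos (hz y (by simp))
        obtain ⟨w', l', r', rfl, hw', hE⟩ := ih' (l := l ++ [y]) (r := r₀) (by simp)
          (by simpa using hz)
        refine ⟨w', l', r', rfl, by simpa using hw', .trans ?_ hE⟩
        have h₂ : Equivalent N N [cross .neg l.length, cross .pos l.length] [] :=
          .of_move (.r2 .neg _) (by simp at hN ⊢; omega) rfl
        refine h₂.append_of_eq (VirtualKnot.overstrand (l.length + 1) r₀.length) w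
          ((isBraid_overstrand _ _).joins ?_) hJ ?_ ?_
        · simp at hN; omega
        · simp [overstrand_succ]
        · simp
      · simp only [List.cons_append, List.cons.injEq] at ha
        obtain ⟨rfl, rfl⟩ := ha
        obtain ⟨w', l', r', rfl, hw', hE⟩ := ih' (l := l) (r := a ++ y :: x :: r₀) (by simp)
          (fun b hb => hz b (by simp at hb ⊢; tauto))
        refine ⟨cross c (l ++ a).length :: w', l', r', rfl, ?_, ?_⟩
        · simpa using Layered.cons (l := l ++ a) h (by simpa using hw')
        · simp only [List.length_append, List.length_cons] at hN hE ⊢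
          refine ((overstrand_cross_of_gt h.ne_virt (i := l.length + a.length)
            (a := l.length) (k := a.length + (r₀.length + 1 + 1)) (by omega) (by omega)
            (by omega)).append_of_eq [] w rfl hJ (by simp [add_assoc]) rfl).trans ?_
          exact hE.append_of_eq [cross c (l.length + a.length)] [] (by simp; omega) rfl (by simp)
            (by simp)

/-- The closure of a virtual strand followed by a layered braid is trivial, if the knot runs
through the layers from the top to the bottom. -/
theorem closure_equivalent {n : ℕ} {y : ℕ} (ht : t.length = n)
    (h : Layered w (t.map (· + 1) ++ [0]) (y :: t)) :
    Equivalent 0 0 (closure (n + 1) (pass .virt (n + 1) ++ w)) circle.word := by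
  induction n generalizing w t y with
  | zero =>
    obtain rfl := List.length_eq_zero_iff.1 ht
    obtain rfl : w = [] := List.eq_nil_iff_forall_not_mem.2 fun x hx => by
      obtain ⟨c, i, -, hi⟩ := h.isBraid x hx
      simp at hi
    exact .refl _ _ _
  | succ n ih =>
    have hw := h.isBraid
    simp only [List.length_append, List.length_map, ht, List.length_singleton] at hw
    obtain ⟨w', l', r', ht', hw', hE⟩ := h.exists_overstrand (N := 2 * (n + 1 + 1))
      (by simp [ht]) (l := t.map (· + 1)) (r := []) rfl (by simp)
    rw [List.append_nil] at hw'
    rcases l' with _ | ⟨y', l⟩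
    -- Here the top strand would end at the leftmost place, so `w'` would permute `t.map (· + 1)`
    -- into `t`. The sums of depths differ by `n + 1`.
    · obtain ⟨rfl, rfl⟩ := List.cons.inj ht'
      have := hw'.perm.sum_eq
      simp [List.sum_map_add, ht] at this
    · obtain ⟨rfl, rfl⟩ := List.cons.inj ht'
      have hpos : ∀ x ∈ y :: (l ++ r'), 0 < x := by
        intro x hx
        obtain ⟨a, -, rfl⟩ := List.mem_map.1 (hw'.perm.mem_iff.2 hx)
        simp
      have hlen : l.length + r'.length = n := by simp at ht; omega
      have hbw' := hw'.isBraid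
      rw [List.length_map, ht] at hbw'
      have hbo : IsBraid (n + 1) (VirtualKnot.overstrand l.length r'.length) := by
        rw [← hlen]; exact isBraid_overstrand _ _
      have hbo' : IsBraid (n + 1 + 1) (VirtualKnot.overstrand (l.length + 1) r'.length) := by
        convert isBraid_overstrand (l.length + 1) r'.length using 1; omega
      have hV := isBraid_pass .virt (n + 1 + 1)
      -- The overstrand at the end of the braid is conjugated to its beginning and moved past the
      -- virtual pass. It then avoids the last strand, whose only remaining crossing is `cross .virt
      -- n`, and destabilization applies.
      have h₁ : Equivalent 0 0 (closure (n + 1 + 1) (pass .virt (n + 1 + 1) ++ w))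
          (closure (n + 1 + 1) ((pass .virt (n + 1 + 1) ++ w') ++
            VirtualKnot.overstrand (l.length + 1) r'.length)) :=
        (hE.append_of_eq (pass .virt (n + 1 + 1)) [] (hV.joins (by omega)) rfl
          (by simp [VirtualKnot.overstrand]) (by simp)).closure
      have h₂ := closure_append_comm (hV.append (hbw'.mono (by omega))) hbo'
      have h₃ : Equivalent 0 0 (closure (n + 1 + 1)
            (VirtualKnot.overstrand (l.length + 1) r'.length ++ (pass .virt (n + 1 + 1) ++ w')))
          (closure (n + 1 + 1) (pass .virt (n + 1) ++ [cross .virt n] ++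
            (VirtualKnot.overstrand l.length r'.length ++ w'))) :=
        ((overstrand_pass_virt (N := 2 * (n + 1 + 1)) (p := n + 1 + 1) (a := l.length)
          (k := r'.length) (by omega) (by omega)).append_of_eq [] w' rfl (hbw'.joins (by omega))
          (by simp) (by simp [pass_succ_succ])).closure
      have h₄ := closure_destabilize .virt (Nat.succ_pos n) (isBraid_pass .virt (n + 1))
        (hbo.append hbw')
      -- All depths drop by one: the strand pulled off is joined to the strand of depth 1, and
      -- together they form the new top layer.
      refine h₁.trans (h₂.trans (h₃.trans (h₄.trans (ih (t := (l ++ r').map (· - 1)) (y := y - 1)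
        (by simp [hlen]) ?_))))
      have h₅ := Layered.overstrand l r' [] (z := 0) fun x hx => hpos x (by simp [hx])
      have h₆ := hw'.map (f := (· - 1)) (by
        intro a ha b hb hab
        obtain ⟨a, -, rfl⟩ := List.mem_map.1 ha
        omega)
      have h₇ : ((l ++ r').map (· - 1)).map (· + 1) = l ++ r' := by
        rw [List.map_map]
        refine (List.map_congr_left fun x hx => ?_).trans (List.map_id _)
        have := hpos x (List.mem_cons_of_mem _ hx)
        simp only [Function.comp_apply, id]
        omega
      rw [h₇]
      simp only [List.map_map, Function.comp_def, Nat.add_sub_cancel, List.map_id'] at h₆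
      exact Layered.trans (by simpa using h₅) (by simpa using h₆)

end Layered

/-! ### Counting crossing changes -/

/-- The second diagram is obtained from the first one by `k` crossing changes. -/
inductive Flips : ℕ → List Piece → List Piece → Prop
  | refl (w : List Piece) : Flips 0 w w
  | head {k : ℕ} {u v w : List Piece} {c : Crossing} {i : ℕ} (hc : c ≠ .virt)
      (h : Flips k (u ++ [cross c.flip i] ++ v) w) : Flips (k + 1) (u ++ [cross c i] ++ v) w

namespace Flips

variable {j k : ℕ} {a b c : List Piece}

theorem trans (h : Flips j a b) (h' : Flips k b c) : Flips (j + k) a c := by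
  induction h with
  | refl => simpa using h'
  | head hc _ ih => rw [Nat.add_right_comm]; exact .head hc (ih h')

theorem context (h : Flips k a b) (u v : List Piece) : Flips k (u ++ a ++ v) (u ++ b ++ v) := by
  induction h with
  | refl => exact .refl _
  | @head k u' v' w c i hc _ ih =>
    simpa using Flips.head (u := u ++ u') (v := v' ++ v) (i := i) hc (by simpa using ih)

theorem append {d : List Piece} (h : Flips j a b) (h' : Flips k c d) :
    Flips (j + k) (a ++ c) (b ++ d) := by
  simpa using (h.context [] c).trans (by simpa using h'.context b [])

theorem unknotsIn (h : Flips k a b) (ha : Joins a 0 0)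
    (hb : ∀ hb : Joins b 0 0, Diagram.toLink ⟨b, hb⟩ = unknot) :
    UnknotsIn k (Diagram.toLink ⟨a, ha⟩) := by
  induction h with
  | refl => rw [hb ha]; exact .zero
  | @head k u v w c i hc _ ih =>
    have ha' : Joins (u ++ [cross c.flip i] ++ v) 0 0 := by
      obtain ⟨l, h, hv⟩ := joins_append_iff.1 ha
      obtain ⟨m, hu, hx⟩ := joins_append_iff.1 h
      exact joins_append (joins_append hu (by simpa using hx)) hv
    exact .succ _ _ _ ⟨⟨_, ha⟩, ⟨_, ha'⟩, rfl, rfl, u, v, c, i, hc, rfl, rfl⟩ (ih ha' hb)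

end Flips

theorem UnknotsIn.virtuallyNullHomotopic {k : ℕ} {K : VirtualLink} (h : UnknotsIn k K) :
    VirtuallyNullHomotopic K := by
  induction h with
  | zero => exact .refl _
  | succ k K L h _ ih => exact .trans _ _ _ (.rel _ _ h) ih

/-- The running strand is over everywhere, so the crossings to change are those with a strand `y <
x`, which has to lie above it. -/
theorem exists_flips_pass_aux (s : List ℕ) (x : ℕ) (l : List ℕ) (hx : x ∉ l) :
    ∃ w, Flips (l.countP (· < x)) ((List.range' s.length l.length).map (cross .pos)) w ∧
      Layered w (s ++ x :: l) (s ++ l ++ [x]) := by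
  induction l generalizing s with
  | nil => exact ⟨[], .refl _, by simpa using Layered.nil _⟩
  | cons y l ih =>
    obtain ⟨hxy, hx⟩ := not_or.1 (mt List.mem_cons.2 hx)
    obtain ⟨w, hw, hL⟩ := ih (s ++ [y]) hx
    have hL' : Layered w (s ++ y :: x :: l) (s ++ y :: l ++ [x]) := by simpa using hL
    have hw' : Flips (l.countP (· < x))
        ((List.range' (s.length + 1) l.length).map (cross .pos)) w := by simpa using hw
    simp only [List.length_cons, List.range'_succ, List.map_cons]
    obtain h | h := lt_or_gt_of_ne hxy
    · refine ⟨cross .pos s.length :: w, ?_, .cons h hL'⟩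
      rw [List.countP_cons_of_neg (by simpa using h.le)]
      simpa using hw'.context [cross .pos s.length] []
    · refine ⟨cross .neg s.length :: w, ?_, .cons h hL'⟩
      rw [List.countP_cons_of_pos (by simpa using h)]
      exact .head (u := []) (by simp) (by
        simpa [Crossing.flip] using hw'.context [cross .neg s.length] [])

theorem exists_flips_pass {x : ℕ} {l : List ℕ} (hx : x ∉ l) :
    ∃ w, Flips (l.countP (· < x)) (pass .pos (l.length + 1)) w ∧
      Layered w (x :: l) (l ++ [x]) := by
  simpa [pass, List.range_eq_range'] using exists_flips_pass_aux [] x l hx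

theorem countP_lt_range {x p : ℕ} (h : x ≤ p) : (List.range p).countP (· < x) = x := by
  induction p, h using Nat.le_induction with
  | base =>
    rw [List.countP_eq_length.2 (by simp), List.length_range]
  | succ p h ih =>
    rw [List.range_succ, List.countP_append, ih, List.countP_singleton]
    simp [h.not_gt]

/-- The depths before the classical pass number `t` of a torus braid on `n + 1` strands. -/
def torusHeights (n q t : ℕ) : List ℕ :=
  (List.range (n + 1)).map fun j => height (n + 1) q (t + j)

theorem torusHeights_eq_cons (n q t : ℕ) : torusHeights n q t = height (n + 1) q t ::
    (List.range n).map fun j => height (n + 1) q (t + j + 1) := by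
  simp [torusHeights, List.range_succ_eq_map, Function.comp_def, add_assoc]

theorem torusHeights_eq_append (n q t : ℕ) : torusHeights n q t =
    ((List.range n).map fun j => height (n + 1) q (t + j)) ++ [height (n + 1) q (t + n)] := by
  simp [torusHeights, List.range_succ]

theorem torusHeights_succ (n q t : ℕ) : torusHeights n q (t + 1) =
    ((List.range n).map fun j => height (n + 1) q (t + j + 1)) ++ [height (n + 1) q t] := by
  rw [torusHeights_eq_append, ← height_add_period (n + 1) q t, add_assoc t 1 n, add_comm 1 n]
  simp only [add_right_comm t 1]

variable {n q : ℕ} (hpq : q.Coprime (n + 1))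
include hpq

theorem torusHeights_nodup (t : ℕ) : (torusHeights n q t).Nodup := by
  refine List.Nodup.map_on (fun i hi j hj h => ?_) List.nodup_range
  have h := Nat.ModEq.add_left_cancel' _ (height_injective hpq h)
  rw [List.mem_range] at hi hj
  rwa [Nat.ModEq, Nat.mod_eq_of_lt hi, Nat.mod_eq_of_lt hj] at h

theorem torusHeights_perm (t : ℕ) : (torusHeights n q t).Perm (List.range (n + 1)) := by
  refine (List.subperm_of_subset (torusHeights_nodup hpq t) fun x hx => ?_).perm_of_length_le
    (by simp [torusHeights])
  obtain ⟨j, -, rfl⟩ := List.mem_map.1 hx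
  exact List.mem_range.2 (height_lt _ _ _)

/-- The heights present are `0, …, n`, each once, so as many strands have to lie above the leftmost
one as its own height says. -/
theorem exists_flips_torus_pass (t : ℕ) :
    ∃ w, Flips (height (n + 1) q t) (pass .pos (n + 1)) w ∧
      Layered w (torusHeights n q t) (torusHeights n q (t + 1)) := by
  have hnd := torusHeights_nodup hpq t
  have hcount := (torusHeights_perm hpq t).countP_eq (· < height (n + 1) q t)
  rw [countP_lt_range (height_lt _ _ _).le] at hcount
  rw [torusHeights_eq_cons] at hnd hcount ⊢
  rw [torusHeights_succ]
  rw [List.countP_cons_of_neg (by simp)] at hcount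
  have := exists_flips_pass (List.nodup_cons.1 hnd).1
  rwa [hcount, List.length_map, List.length_range] at this

theorem exists_flips_torus_passes (m : ℕ) :
    ∃ w, Flips (∑ t ∈ Finset.range m, height (n + 1) q t)
      ((List.range m).flatMap fun _ => pass .pos (n + 1)) w ∧
      Layered w (torusHeights n q 0) (torusHeights n q m) := by
  induction m with
  | zero => exact ⟨[], .refl _, .nil _⟩
  | succ m ih =>
    obtain ⟨u, hu, hu'⟩ := ih
    obtain ⟨v, hv, hv'⟩ := exists_flips_torus_pass hpq m
    refine ⟨u ++ v, ?_, hu'.trans hv'⟩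
    rw [Finset.sum_range_succ, List.range_succ, List.flatMap_append]
    exact hu.append (by simpa using hv)

-- The heights meet the closing condition of `Layered.closure_equivalent`: along the virtual pass a
-- strand that moves one place to the left goes one layer down, and the virtual strand ends at the
-- place of height 0.
omit hpq in
theorem unknotsIn_VT {m : ℕ} (hpq : (m + 1).Coprime (n + 1)) :
    UnknotsIn (∑ t ∈ Finset.range m, height (n + 1) (m + 1) t) (VT (n + 1) (m + 1) 1) := by
  obtain ⟨w, hw, hL⟩ := exists_flips_torus_passes hpq m
  have hF : Flips (∑ t ∈ Finset.range m, height (n + 1) (m + 1) t)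
      (virtualTorusDiagram (n + 1) (m + 1) 1).word (closure (n + 1) (pass .virt (n + 1) ++ w)) := by
    simpa [virtualTorusDiagram, closure, virtualTorusBraid_one] using
      hw.context ((List.range (n + 1)).map cup ++ pass .virt (n + 1))
        ((List.range (n + 1)).reverse.map cap)
  refine hF.unknotsIn _ fun hJ => Equivalent.toLink_eq (E := circle) ?_
  refine Layered.closure_equivalent
    (t := (List.range n).map fun j => height (n + 1) (m + 1) (m + j + 1))
    (y := height (n + 1) (m + 1) m) (by simp) ?_
  rw [← torusHeights_eq_cons]
  convert hL using 1
  rw [torusHeights_eq_append, List.map_map, zero_add, height_of_add_one_eq (n + 1) (m + 1) rfl]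
  congr 1
  refine List.map_congr_left fun j hj => ?_
  rw [List.mem_range] at hj
  rw [zero_add, height_add hpq (j := j) (Nat.not_dvd_of_pos_of_lt (by omega) (by omega)),
    Function.comp_apply, add_comm j, add_right_comm]

end VirtualKnot

/-! ### The virtual unknotting number -/

theorem theorem1 (p q : ℕ) (hp : 0 < p) (hq : 0 < q) (hpq : Nat.Coprime p q) :
    VirtualKnot.VirtuallyNullHomotopic (VirtualKnot.VT p q 1) ∧
      (VirtualKnot.virtualUnknottingNumber (VirtualKnot.VT p q 1) : ℚ) =
        ((p : ℚ) - 1) * ((q : ℚ) - 1) / 2 := by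
  obtain ⟨n, rfl⟩ := Nat.exists_eq_succ_of_ne_zero hp.ne'
  obtain ⟨m, rfl⟩ := Nat.exists_eq_succ_of_ne_zero hq.ne'
  have hpq := hpq.symm
  have hU := VirtualKnot.unknotsIn_VT hpq
  have hsum := VirtualKnot.sum_height (p := n + 1) (q := m + 1) hpq m rfl
  refine ⟨hU.virtuallyNullHomotopic, ?_⟩
  have hle : VirtualKnot.virtualUnknottingNumber (VirtualKnot.VT (n + 1) (m + 1) 1) ≤ _ :=
    Nat.sInf_le hU
  -- The infimum is attained because the set is nonempty by `hU`, so the lower bound applies to it.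
  have hmem : VirtualKnot.UnknotsIn
      (VirtualKnot.virtualUnknottingNumber (VirtualKnot.VT (n + 1) (m + 1) 1)) _ :=
    Nat.sInf_mem (s := {k | VirtualKnot.UnknotsIn k (VirtualKnot.VT (n + 1) (m + 1) 1)}) ⟨_, hU⟩
  have hge := hmem.abs_weight_le (VirtualKnot.mem_weights_VT hpq)
  rw [abs_of_nonneg (by positivity)] at hge
  have hge : m * n ≤
      2 * VirtualKnot.virtualUnknottingNumber (VirtualKnot.VT (n + 1) (m + 1) 1) := by
    exact_mod_cast hge
  rw [Nat.add_sub_cancel, mul_comm n m] at hsum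
  have h : 2 * VirtualKnot.virtualUnknottingNumber (VirtualKnot.VT (n + 1) (m + 1) 1) = m * n := by
    omega
  have h : (2 * VirtualKnot.virtualUnknottingNumber (VirtualKnot.VT (n + 1) (m + 1) 1) : ℚ) =
      m * n := by
    exact_mod_cast h
  push_cast
  linear_combination h / 2
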